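/- For integers $a,b\ge 1$ and a graph $H$, let $ex_{b,c}(a,b,H)$ denote the maximum number of edges in a connected bipartite graph with parts of sizes $a$ and $b$ that does not contain $H$ as a (not necessarily induced) subgraph, and let $P_n$ denote the path on $n$ vertices. Then for every $k\ge 3$ and all $b\ge a\ge k$, $$ex_{b,c}(a,b,P_{2k})=ex_{b,c}(a,b,P_{2k-1})=(k-2)(b-1)+a.$$ In particular, both maxima are attained: there are connected bipartite graphs with parts of sizes $a$ and $b$ and exactly $(k-2)(b-1)+a$ edges that are $P_{2k}$-free, respectively $P_{2k-1}$-free, and no such graph has more edges. -/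

import Mathlib

/-- The numbers of edges of the connected bipartite graphs with part sizes `a` and `b`
that do not contain `H` as a (not necessarily induced) subgraph. -/
def connBipartiteFreeEdgeCounts (a b : ℕ) {W : Type*} (H : SimpleGraph W) : Set ℕ :=
  {m | ∃ (V : Type) (_ : Finite V) (G : SimpleGraph V) (A B : Set V),
    A ∪ B = Set.univ ∧ G.IsBipartiteWith A B ∧ A.ncard = a ∧ B.ncard = b ∧
    G.Connected ∧ H.Free G ∧ G.edgeSet.ncard = m}

/-- The connected bipartite Turán number: the maximum number of edges in a connected bipartite
graph with part sizes `a` and `b` and with no `H` as a subgraph. -/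
noncomputable def exBipartiteConn (a b : ℕ) {W : Type*} (H : SimpleGraph W) : ℕ :=
  sSup (connBipartiteFreeEdgeCounts a b H)

set_option linter.unusedSectionVars false

/-! Write `m = k - 2`. For the lower bound, join `m` vertices of the smaller side to the whole other
side and hang the remaining ones from a single vertex of that side. A vertex of the smaller side
that is interior to a path must be one of the `m` full ones, and this excludes a path on `2 * m + 3`
vertices.

The upper bound is needed only for graphs without a path on `2 * m + 4` vertices. Induct on `m`, and
for fixed `m` on the size of the graph. Near a longest path there is a vertex of the larger side, or
a pair with one vertex on each side, whose deletion keeps the graph connected and costs no more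
edges than the bound loses: `m` for the vertex, `m + 1` for the pair.

If there is no path on `2 * m + 3` vertices, connectivity rules out a cycle on `2 * m + 2` vertices,
and the ends of a path on `2 * m + 2` vertices form such a pair (`exists_pair_of_even_path`). If
even that path is missing, the bound for `m - 1` applies.

If a longest path has `2 * m + 3` vertices, both its ends lie on one side. When that side is not the
larger one, an end of the path and a depth-first leaf off the path have degree sum at most `m + 1`
(`exists_path_to_leaf`, `exists_pair_of_odd_path`). When it is the larger one,
`exists_vertex_of_odd_path` supplies a single vertex. One case escapes induction: both sides of size
`m + 2`, with a cycle missing one vertex of each. There the edges are counted directly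
(`card_interedges_le_of_cycle`). -/

namespace BipartitePath

/-! ### Paths, bipartitions and connected vertex sets -/

section

variable {V : Type*} [DecidableEq V] {G : SimpleGraph V}

/-- `l` lists the vertices of a path of `G` inside `S`. -/
structure IsPathIn (G : SimpleGraph V) (S : Finset V) (l : List V) : Prop where
  chain : l.IsChain G.Adj
  nodup : l.Nodup
  mem : ∀ v ∈ l, v ∈ S

/-- `G` induces a connected graph on `S`: no nonempty proper subset of `S` is closed under
adjacency within `S`. -/
def CutConnected (G : SimpleGraph V) (S : Finset V) : Prop :=
  ∀ T ⊆ S, T.Nonempty → (∀ u ∈ T, ∀ v ∈ S, G.Adj u v → v ∈ T) → T = S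

/-- `A` and `B` are disjoint independent sets of `G`. -/
structure BipartiteOn (G : SimpleGraph V) (A B : Finset V) : Prop where
  disjoint : Disjoint A B
  left : ∀ u ∈ A, ∀ v ∈ A, ¬ G.Adj u v
  right : ∀ u ∈ B, ∀ v ∈ B, ¬ G.Adj u v

namespace BipartiteOn

variable {A B : Finset V}

lemma symm (h : BipartiteOn G A B) : BipartiteOn G B A := ⟨h.disjoint.symm, h.right, h.left⟩

lemma mono (h : BipartiteOn G A B) {A' B' : Finset V} (hA : A' ⊆ A) (hB : B' ⊆ B) :
    BipartiteOn G A' B' :=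
  ⟨Finset.disjoint_of_subset_left hA (Finset.disjoint_of_subset_right hB h.disjoint),
    fun u hu v hv => h.left u (hA hu) v (hA hv), fun u hu v hv => h.right u (hB hu) v (hB hv)⟩

lemma notMem_right (h : BipartiteOn G A B) {v : V} (hv : v ∈ A) : v ∉ B :=
  Finset.disjoint_left.1 h.disjoint hv

lemma mem_right (h : BipartiteOn G A B) {u v : V} (hu : u ∈ A) (hv : v ∈ A ∪ B)
    (huv : G.Adj u v) : v ∈ B := by
  rcases Finset.mem_union.1 hv with hv | hv
  · exact absurd huv (h.left u hu v hv)
  · exact hv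

lemma mem_left (h : BipartiteOn G A B) {u v : V} (hu : u ∈ B) (hv : v ∈ A ∪ B)
    (huv : G.Adj u v) : v ∈ A :=
  h.symm.mem_right hu (by rwa [Finset.union_comm]) huv

end BipartiteOn

namespace IsPathIn

variable {S : Finset V} {l l₁ l₂ : List V}

lemma mono (h : IsPathIn G S l) {S' : Finset V} (hS : S ⊆ S') : IsPathIn G S' l :=
  ⟨h.chain, h.nodup, fun v hv => hS (h.mem v hv)⟩

lemma singleton {v : V} (hv : v ∈ S) : IsPathIn G S [v] := ⟨by simp, by simp, by simpa⟩

lemma append (h₁ : IsPathIn G S l₁) (h₂ : IsPathIn G S l₂) (hd : ∀ v ∈ l₁, v ∉ l₂)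
    (hadj : ∀ x ∈ l₁.getLast?, ∀ y ∈ l₂.head?, G.Adj x y) : IsPathIn G S (l₁ ++ l₂) := by
  refine ⟨List.isChain_append.2 ⟨h₁.chain, h₂.chain, hadj⟩, ?_, ?_⟩
  · exact List.nodup_append'.2 ⟨h₁.nodup, h₂.nodup, fun v hv hv' => hd v hv hv'⟩
  · intro v hv
    rcases List.mem_append.1 hv with hv | hv
    exacts [h₁.mem v hv, h₂.mem v hv]

lemma cons (h : IsPathIn G S l) {v : V} (hv : v ∈ S) (hvl : v ∉ l)
    (hadj : ∀ y ∈ l.head?, G.Adj v y) : IsPathIn G S (v :: l) := by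
  have := (singleton (G := G) hv).append h (by simpa) (by simpa using hadj)
  simpa using this

lemma reverse (h : IsPathIn G S l) : IsPathIn G S l.reverse := by
  refine ⟨?_, List.nodup_reverse.2 h.nodup, fun v hv => h.mem v (List.mem_reverse.1 hv)⟩
  rw [List.isChain_reverse]
  exact h.chain.imp fun a b hab => hab.symm

lemma infix_of (h : IsPathIn G S l) (hl : l₁ <:+: l) : IsPathIn G S l₁ :=
  ⟨h.chain.infix hl, h.nodup.sublist hl.sublist, fun v hv => h.mem v (hl.subset hv)⟩

lemma take (h : IsPathIn G S l) (n : ℕ) : IsPathIn G S (l.take n) :=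
  h.infix_of (List.take_prefix n l).isInfix

lemma drop (h : IsPathIn G S l) (n : ℕ) : IsPathIn G S (l.drop n) :=
  h.infix_of (List.drop_suffix n l).isInfix

lemma adj (h : IsPathIn G S l) {i : ℕ} (hi : i + 1 < l.length) : G.Adj l[i] l[i + 1] :=
  List.isChain_iff_getElem.1 h.chain i hi

lemma notMem_drop_of_mem_take (h : IsPathIn G S l) {p r : ℕ} (hpr : p ≤ r) {v : V}
    (hv : v ∈ l.take p) : v ∉ l.drop r :=
  fun hv' => List.disjoint_take_drop h.nodup hpr hv hv'

/-- Cut out `l[p+1], …, l[r-1]` and reverse the initial segment, using an edge `l[0] l[r]`. -/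
lemma flip (h : IsPathIn G S l) {p r : ℕ} (hpr : p < r)
    (hadj : ∀ x ∈ l[0]?, ∀ y ∈ l[r]?, G.Adj x y) :
    IsPathIn G S ((l.take (p + 1)).reverse ++ l.drop r) := by
  refine (h.take _).reverse.append (h.drop _) ?_ ?_
  · intro v hv
    exact h.notMem_drop_of_mem_take hpr (List.mem_reverse.1 hv)
  · intro x hx y hy
    rw [List.getLast?_reverse, List.head?_take] at hx
    rw [List.head?_drop] at hy
    refine hadj x ?_ y hy
    simpa [List.head?_eq_getElem?] using hx

lemma mem_head_of_maximal (h : IsPathIn G S l)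
    (hmax : ∀ l', IsPathIn G S l' → l'.length ≠ l.length + 1) {x : V} (hx : x ∈ l.head?) {v : V}
    (hv : v ∈ S) (hxv : G.Adj x v) : v ∈ l := by
  by_contra hvl
  refine hmax (v :: l) (h.cons hv hvl ?_) (by simp)
  intro y hy
  rw [Option.mem_def.1 hx, Option.mem_some_iff] at hy
  exact hy ▸ hxv.symm

/-- A path alternates between the two sides. -/
lemma getElem_mem {X Y : Finset V} (h : IsPathIn G (X ∪ Y) l) (hXY : BipartiteOn G X Y)
    (h0 : ∀ x ∈ l[0]?, x ∈ X) {i : ℕ} (hi : i < l.length) :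
    (i % 2 = 0 → l[i] ∈ X) ∧ (i % 2 = 1 → l[i] ∈ Y) := by
  induction i with
  | zero => exact ⟨fun _ => h0 _ (by simp), by simp⟩
  | succ i ih =>
    have ih := ih (by omega)
    have hadj := h.adj hi
    have hm := h.mem l[i + 1] (List.getElem_mem hi)
    constructor
    · intro h1
      exact hXY.mem_left (ih.2 (by omega)) hm hadj
    · intro h1
      exact hXY.mem_right (ih.1 (by omega)) hm hadj

end IsPathIn

namespace CutConnected

variable {S K : Finset V}

lemma exists_adj (h : CutConnected G S) {T : Finset V} (hTS : T ⊆ S) (hT : T.Nonempty)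
    (hne : T ≠ S) : ∃ u ∈ T, ∃ v ∈ S, v ∉ T ∧ G.Adj u v := by
  by_contra! hc
  refine hne (h T hTS hT fun u hu v hv huv => ?_)
  by_contra hvT
  exact hc u hu v hv hvT huv

lemma exists_neighbor (h : CutConnected G S) {x : V} (hx : x ∈ S) (hS : 1 < S.card) :
    ∃ v ∈ S, G.Adj x v := by
  obtain ⟨u, hu, v, hv, -, huv⟩ := h.exists_adj (T := {x}) (by simpa) (by simp)
    (by rintro rfl; simp at hS)
  rw [Finset.mem_singleton] at hu
  exact ⟨v, hv, hu ▸ huv⟩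

lemma insert (h : CutConnected G K) {u v : V} (hu : u ∈ K) (huv : G.Adj u v) :
    CutConnected G (insert v K) := by
  intro T hT hTne hcl
  have key : u ∈ T ↔ v ∈ T :=
    ⟨fun hh => hcl u hh v (by simp) huv, fun hh => hcl v hh u (by simp [hu]) huv.symm⟩
  have hne : (T ∩ K).Nonempty := by
    obtain ⟨w, hw⟩ := hTne
    rcases Finset.mem_insert.1 (hT hw) with rfl | hwK
    · exact ⟨u, by simp [hu, key.2 hw]⟩
    · exact ⟨w, by simp [hw, hwK]⟩
  have hK : T ∩ K = K := h _ Finset.inter_subset_right hne (by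
    intro a ha b hb hab
    rw [Finset.mem_inter] at ha ⊢
    exact ⟨hcl a ha.1 b (by simp [hb]) hab, hb⟩)
  have hKT : K ⊆ T := Finset.inter_eq_right.1 hK
  exact Finset.Subset.antisymm hT (Finset.insert_subset (key.1 (hKT hu)) hKT)

lemma union_list {q : List V} : ∀ {K : Finset V}, CutConnected G K → q.IsChain G.Adj →
    (∀ c ∈ q.head?, ∃ u ∈ K, G.Adj u c) → CutConnected G (K ∪ q.toFinset) := by
  induction q with
  | nil => intro K h _ _; simpa
  | cons c q ih =>
    intro K h hq hc
    obtain ⟨u, hu, huc⟩ := hc c (by simp)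
    have := ih (h.insert hu huc) hq.tail (by
      intro d hd
      refine ⟨c, by simp, ?_⟩
      exact (List.isChain_cons.1 hq).1 d hd)
    rwa [show K ∪ (c :: q).toFinset = Insert.insert c K ∪ q.toFinset by ext; simp]

lemma toFinset {q : List V} (hq : q.IsChain G.Adj) : CutConnected G q.toFinset := by
  cases q with
  | nil =>
    intro T hT _ _
    exact Finset.Subset.antisymm hT (by simp)
  | cons c q =>
    have h1 : CutConnected G {c} := by
      intro T hT hne _
      exact (Finset.subset_singleton_iff.1 hT).resolve_left hne.ne_empty
    have := union_list h1 hq.tail (by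
      intro d hd
      exact ⟨c, by simp, (List.isChain_cons.1 hq).1 d hd⟩)
    rwa [show (c :: q).toFinset = {c} ∪ q.toFinset by ext; simp]

/-- Deleting vertices whose remaining neighbours lie in a connected set keeps connectivity. -/
lemma sdiff (h : CutConnected G S) {D : Finset V} (hK : CutConnected G K) (hKS : K ⊆ S \ D)
    (hKne : K.Nonempty) (hD : ∀ d ∈ D, ∀ v ∈ S \ D, G.Adj d v → v ∈ K) :
    CutConnected G (S \ D) := by
  -- A closed set that avoids `K` receives no edge from `D`, so it is closed in `S` as well. Applied
  -- to both `T` and its complement, this contradicts the connectedness of `K`.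
  have aux : ∀ T ⊆ S \ D, T.Nonempty → (∀ u ∈ T, ∀ v ∈ S \ D, G.Adj u v → v ∈ T) →
      (T ∩ K).Nonempty := by
    intro T hT hTne hcl
    by_contra hem
    rw [Finset.not_nonempty_iff_eq_empty] at hem
    have hTS : T = S := by
      refine h T (hT.trans Finset.sdiff_subset) hTne fun u hu v hv huv => ?_
      by_cases hvD : v ∈ D
      · have : u ∈ T ∩ K := Finset.mem_inter.2 ⟨hu, hD v hvD u (hT hu) huv.symm⟩
        simp [hem] at this
      · exact hcl u hu v (by simp [hv, hvD]) huv
    obtain ⟨w, hw⟩ := hKne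
    have : w ∈ T ∩ K := Finset.mem_inter.2 ⟨hTS ▸ (Finset.mem_sdiff.1 (hKS hw)).1, hw⟩
    simp [hem] at this
  intro T hT hTne hcl
  have h1 := aux T hT hTne hcl
  have h2 : T ∩ K = K := hK _ Finset.inter_subset_right h1 (by
    intro a ha b hb hab
    rw [Finset.mem_inter] at ha ⊢
    exact ⟨hcl a ha.1 b (hKS hb) hab, hb⟩)
  by_contra hne
  have h3 : ((S \ D) \ T).Nonempty := by
    rw [Finset.sdiff_nonempty]
    exact fun hsub => hne (Finset.Subset.antisymm hT hsub)
  obtain ⟨w, hw⟩ := aux _ Finset.sdiff_subset h3 (by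
    intro u hu v hv huv
    rw [Finset.mem_sdiff] at hu ⊢
    exact ⟨hv, fun hvT => hu.2 (hcl v hvT u hu.1 huv.symm)⟩)
  rw [Finset.mem_inter, Finset.mem_sdiff] at hw
  exact hw.1.2 (Finset.inter_eq_right.1 h2 hw.2)

end CutConnected

lemma IsPathIn.card_inter {l : List V} : ∀ {X Y : Finset V}, IsPathIn G (X ∪ Y) l →
    BipartiteOn G X Y → (∀ x ∈ l[0]?, x ∈ X) →
    (X ∩ l.toFinset).card = (l.length + 1) / 2 ∧ (Y ∩ l.toFinset).card = l.length / 2 := by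
  induction l with
  | nil => intro X Y _ _ _; simp
  | cons c l ih =>
    intro X Y h hXY h0
    have hc : c ∈ X := h0 c (by simp)
    have hcl : c ∉ l := (List.nodup_cons.1 h.nodup).1
    have h' : IsPathIn G (Y ∪ X) l := by
      rw [Finset.union_comm]
      exact h.infix_of (List.suffix_cons c l).isInfix
    obtain ⟨h1, h2⟩ := ih h' hXY.symm (by
      intro d hd
      rw [← List.head?_eq_getElem?] at hd
      exact hXY.mem_right hc (by rw [Finset.union_comm]; exact h'.mem d (List.mem_of_mem_head? hd))
        ((List.isChain_cons.1 h.chain).1 d hd))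
    have e1 : X ∩ (c :: l).toFinset = insert c (X ∩ l.toFinset) := by
      rw [List.toFinset_cons, Finset.inter_insert_of_mem hc]
    have e2 : Y ∩ (c :: l).toFinset = Y ∩ l.toFinset := by
      rw [List.toFinset_cons, Finset.inter_insert_of_notMem (hXY.notMem_right hc)]
    rw [e1, e2, Finset.card_insert_of_notMem (by simp [hcl]), h1, h2, List.length_cons]
    omega

/-! ### Depth-first search for a leaf on the larger side -/

/-- A vertex set with more vertices in `Y` than in `X` contains a path, starting at a vertex with
property `ρ`, whose last vertex lies in `Y` and has no neighbour in the set off the path. -/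
lemma exists_path_to_leaf {X Y : Finset V} (hXY : BipartiteOn G X Y) (n : ℕ) :
    ∀ S ⊆ X ∪ Y, S.card = n → ∀ ρ : V → Prop,
      (∀ T ⊆ S, T.Nonempty → (∀ u ∈ T, ∀ v ∈ S, G.Adj u v → v ∈ T) → ∃ t ∈ T, ρ t) →
      S.Nonempty →
      ((S ∩ X).card < (S ∩ Y).card ∨ (S ∩ X).card ≤ (S ∩ Y).card ∧ ∀ v ∈ S, ρ v → v ∈ X) →
      ∃ q, IsPathIn G S q ∧ (∃ c ∈ q.head?, ρ c) ∧
        ∃ c ∈ q.getLast?, c ∈ Y ∧ ∀ v ∈ S, G.Adj c v → v ∈ q := by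
  classical
  -- In a depth-first forest all neighbours of a leaf are its ancestors, so the root path to a leaf
  -- in `Y` is as required. If no leaf were in `Y`, each vertex of `Y` would have a child of its own
  -- in `X`, so `Y` could not outnumber `X`, nor even equal it if all roots were in `X`. The
  -- induction builds this forest implicitly.
  induction n using Nat.strong_induction_on with
  | _ n ih =>
  intro S hS hn ρ hρ hne hcard
  obtain ⟨r, hr, hρr⟩ := hρ S (Finset.Subset.refl _) hne fun _ _ v hv _ => hv
  -- The component of `r` in `S`, as the least closed set containing `r`.
  set C := S.filter fun v => ∀ D ⊆ S, (∀ u ∈ D, ∀ w ∈ S, G.Adj u w → w ∈ D) → r ∈ D → v ∈ D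
    with hC
  have hCS : C ⊆ S := Finset.filter_subset _ _
  have hrC : r ∈ C := Finset.mem_filter.2 ⟨hr, fun D _ _ h => h⟩
  have hCcl : ∀ u ∈ C, ∀ v ∈ S, G.Adj u v → v ∈ C := by
    intro u hu v hv huv
    refine Finset.mem_filter.2 ⟨hv, fun D hD hcl hrD => ?_⟩
    exact hcl u ((Finset.mem_filter.1 hu).2 D hD hcl hrD) v hv huv
  have hCmin : ∀ D ⊆ S, (∀ u ∈ D, ∀ w ∈ S, G.Adj u w → w ∈ D) → r ∈ D → C ⊆ D :=
    fun D hD hcl hrD v hv => (Finset.mem_filter.1 hv).2 D hD hcl hrD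
  have hsplit : ∀ Z : Finset V, (S ∩ Z).card = ((S \ C) ∩ Z).card + (C ∩ Z).card := by
    intro Z
    rw [← Finset.card_union_of_disjoint, ← Finset.union_inter_distrib_right,
      Finset.sdiff_union_of_subset hCS]
    exact Finset.disjoint_of_subset_left Finset.inter_subset_left
      (Finset.disjoint_of_subset_right Finset.inter_subset_left Finset.sdiff_disjoint)
  have hCpos : 0 < C.card := Finset.card_pos.2 ⟨r, hrC⟩
  have hCle := Finset.card_le_card hCS
  -- continue in the component of `r`, below `r`
  have inside : (C.erase r).Nonempty →
      (((C.erase r) ∩ X).card < ((C.erase r) ∩ Y).card ∨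
        ((C.erase r) ∩ X).card ≤ ((C.erase r) ∩ Y).card ∧
          ∀ v ∈ C.erase r, G.Adj r v → v ∈ X) →
      ∃ q, IsPathIn G S q ∧ (∃ c ∈ q.head?, ρ c) ∧
        ∃ c ∈ q.getLast?, c ∈ Y ∧ ∀ v ∈ S, G.Adj c v → v ∈ q := by
    intro hne' hcard'
    have hsub : C.erase r ⊆ S := (Finset.erase_subset _ _).trans hCS
    obtain ⟨q, hq, ⟨c, hc, hrc⟩, d, hd, hdY, hdq⟩ := ih (C.erase r).card
      (by rw [Finset.card_erase_of_mem hrC]; omega)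
      (C.erase r) (hsub.trans hS) rfl (fun v => G.Adj r v) (by
        intro T hT hTne hTcl
        by_contra! hno
        -- Without a neighbour of `r` in `T`, the set `C \ T` would be a smaller closed set
        -- containing `r`.
        have hsub' := hCmin (C \ T) (Finset.sdiff_subset.trans hCS) (by
          intro u hu w hw huw
          rw [Finset.mem_sdiff] at hu ⊢
          refine ⟨hCcl u hu.1 w hw huw, fun hwT => ?_⟩
          by_cases hur : u = r
          · exact hno w hwT (hur ▸ huw)
          · exact hu.2 (hTcl w hwT u (Finset.mem_erase.2 ⟨hur, hu.1⟩) huw.symm))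
          (Finset.mem_sdiff.2 ⟨hrC, fun hrT => by simpa using hT hrT⟩)
        obtain ⟨t, ht⟩ := hTne
        exact (Finset.mem_sdiff.1 (hsub' (Finset.mem_of_mem_erase (hT ht)))).2 ht)
      hne' hcard'
    have hqne : q ≠ [] := by rintro rfl; simp at hc
    refine ⟨r :: q, (hq.mono hsub).cons hr (fun hrq => by simpa using hq.mem r hrq) ?_,
      ⟨r, by simp, hρr⟩, d, ?_, hdY, ?_⟩
    · intro y hy
      rw [Option.mem_def.1 hc, Option.mem_some_iff] at hy
      exact hy ▸ hrc
    · rw [List.getLast?_cons_of_ne_nil hqne]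
      exact hd
    · intro v hv hdv
      have hdC : d ∈ C := Finset.mem_of_mem_erase (hq.mem d (List.mem_of_getLast? hd))
      by_cases hvr : v = r
      · simp [hvr]
      · exact List.mem_cons_of_mem _ (hdq v (Finset.mem_erase.2 ⟨hvr, hCcl d hdC v hv hdv⟩) hdv)
  -- continue outside the component of `r`
  have outside : ((S \ C) ∩ X).card < ((S \ C) ∩ Y).card →
      ∃ q, IsPathIn G S q ∧ (∃ c ∈ q.head?, ρ c) ∧
        ∃ c ∈ q.getLast?, c ∈ Y ∧ ∀ v ∈ S, G.Adj c v → v ∈ q := by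
    intro hcard'
    obtain ⟨q, hq, hc, d, hd, hdY, hdq⟩ := ih (S \ C).card
      (by rw [Finset.card_sdiff_of_subset hCS]; omega)
      (S \ C) (Finset.sdiff_subset.trans hS) rfl ρ (by
        intro T hT hTne hTcl
        refine hρ T (hT.trans Finset.sdiff_subset) hTne fun u hu v hv huv => ?_
        refine hTcl u hu v (Finset.mem_sdiff.2 ⟨hv, fun hvC => ?_⟩) huv
        have hu' := Finset.mem_sdiff.1 (hT hu)
        exact hu'.2 (hCcl v hvC u hu'.1 huv.symm))
      (by
        have : 0 < ((S \ C) ∩ Y).card := by omega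
        exact (Finset.card_pos.1 this).mono Finset.inter_subset_left)
      (Or.inl hcard')
    refine ⟨q, hq.mono Finset.sdiff_subset, hc, d, hd, hdY, fun v hv hdv => ?_⟩
    have hd' := Finset.mem_sdiff.1 (hq.mem d (List.mem_of_getLast? hd))
    exact hdq v (Finset.mem_sdiff.2 ⟨hv, fun hvC => hd'.2 (hCcl v hvC d hd'.1 hdv.symm)⟩) hdv
  have hX := hsplit X
  have hY := hsplit Y
  by_cases hrY : r ∈ Y
  · have hrX : r ∉ X := hXY.symm.notMem_right hrY
    have hlt : (S ∩ X).card < (S ∩ Y).card := by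
      rcases hcard with h | h
      · exact h
      · exact absurd (h.2 r hr hρr) hrX
    by_cases hCc : (C ∩ X).card < (C ∩ Y).card
    · by_cases hCr : (C.erase r).Nonempty
      -- Deleting `r` from `Y` may leave only equality, but the new roots are neighbours of `r`,
      -- hence in `X`.
      · refine inside hCr (Or.inr ⟨?_, fun v hv hrv =>
          hXY.mem_left hrY (hS (hCS (Finset.mem_of_mem_erase hv))) hrv⟩)
        rw [Finset.erase_inter, Finset.erase_inter, Finset.card_erase_of_mem
          (Finset.mem_inter.2 ⟨hrC, hrY⟩), Finset.erase_eq_of_notMem (by simp [hrX])]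
        omega
      · refine ⟨[r], IsPathIn.singleton hr, ⟨r, by simp, hρr⟩, r, by simp, hrY, ?_⟩
        intro v hv hrv
        exact absurd ⟨v, Finset.mem_erase.2 ⟨hrv.ne', hCcl r hrC v hv hrv⟩⟩ hCr
    · exact outside (by omega)
  · have hrX : r ∈ X := (Finset.mem_union.1 (hS hr)).resolve_right hrY
    have hle : (S ∩ X).card ≤ (S ∩ Y).card := by omega
    by_cases hCc : (C ∩ X).card ≤ (C ∩ Y).card
    · have hlt : ((C.erase r) ∩ X).card < ((C.erase r) ∩ Y).card := by
        rw [Finset.erase_inter, Finset.erase_inter, Finset.card_erase_of_mem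
          (Finset.mem_inter.2 ⟨hrC, hrX⟩), Finset.erase_eq_of_notMem (by simp [hrY])]
        have : 0 < (C ∩ X).card := Finset.card_pos.2 ⟨r, Finset.mem_inter.2 ⟨hrC, hrX⟩⟩
        omega
      refine inside ?_ (Or.inl hlt)
      exact (Finset.card_pos.1 (by omega : 0 < ((C.erase r) ∩ Y).card)).mono
        Finset.inter_subset_left
    · exact outside (by omega)

/-- Neighbours on a path are counted through their indices; covering them suffices, so no
injectivity is needed. -/
lemma card_le_of_forall_exists {N : Finset V} {J : Finset ℕ} (f : ℕ → V)
    (h : ∀ v ∈ N, ∃ j ∈ J, f j = v) : N.card ≤ J.card :=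
  Finset.card_le_card_of_surjOn f fun v hv => by
    obtain ⟨j, hj, rfl⟩ := h v hv
    exact ⟨j, hj, rfl⟩

/-! ### Cheap deletions at the end of a longest path -/

/-- In the absence of a longer path and of a cycle on as many vertices, the two ends of a path with
an even number of vertices can be deleted cheaply. -/
lemma exists_pair_of_even_path [DecidableRel G.Adj] {A B : Finset V} (hAB : BipartiteOn G A B)
    {m : ℕ} (hconn : CutConnected G (A ∪ B)) {l : List V} (hl : IsPathIn G (A ∪ B) l)
    (hlen : l.length = 2 * m) (hm : 1 ≤ m) (h0 : ∀ x ∈ l[0]?, x ∈ A)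
    (hmax : ∀ l', IsPathIn G (A ∪ B) l' → l'.length ≠ 2 * m + 1)
    (hcyc : ∀ l', IsPathIn G (A ∪ B) l' → l'.length = 2 * m →
      ∀ x ∈ l'.head?, ∀ y ∈ l'.getLast?, ¬ G.Adj x y) :
    ∃ x ∈ A, ∃ y ∈ B, ¬ G.Adj x y ∧
      (B.filter (G.Adj x)).card + (A.filter (G.Adj y)).card ≤ m ∧
      CutConnected G ((A ∪ B) \ {x, y}) := by
  have hal := fun {i} (hi : i < l.length) => hl.getElem_mem hAB h0 hi
  have hx0 : l[0] ∈ l.head? := by simp [List.head?_eq_getElem?]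
  have hy0 : l[2 * m - 1] ∈ l.reverse.head? := by
    simp [List.getLast?_eq_getElem?, hlen]
  have hy1 : l[2 * m - 1] ∈ l.getLast? := by simpa using hy0
  have hmax' : ∀ l', IsPathIn G (A ∪ B) l' → l'.length ≠ l.length + 1 := by rwa [hlen]
  have hNx : ∀ v ∈ A ∪ B, G.Adj l[0] v → v ∈ l := fun v hv h =>
    hl.mem_head_of_maximal hmax' hx0 hv h
  have hNy : ∀ v ∈ A ∪ B, G.Adj l[2 * m - 1] v → v ∈ l := fun v hv h => by
    simpa using hl.reverse.mem_head_of_maximal (by simpa using hmax') hy0 hv h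
  have hxy : ¬ G.Adj l[0] l[2 * m - 1] := hcyc l hl hlen _ hx0 _ hy1
  -- A single edge counts as a cycle on two vertices, so `hcyc` excludes `m = 1`.
  have hm2 : 2 ≤ m := by
    by_contra hlt
    obtain rfl : m = 1 := by omega
    exact hxy (hl.adj (i := 0) (by omega))
  refine ⟨l[0], (hal (by omega)).1 rfl, l[2 * m - 1], (hal (by omega)).2 (by omega), hxy, ?_, ?_⟩
  · set x := l[0] with hx
    set y := l[2 * m - 1] with hy
    set J := (Finset.range m).filter fun j => G.Adj x (l.getD (2 * j + 1) x)
    set Z := (Finset.range m).filter fun j => G.Adj y (l.getD (2 * j) x)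
    have hJ : (B.filter (G.Adj x)).card ≤ J.card := by
      refine card_le_of_forall_exists (fun j => l.getD (2 * j + 1) x) fun v hv => ?_
      rw [Finset.mem_filter] at hv
      obtain ⟨i, hi, rfl⟩ := List.getElem_of_mem (hNx v (Finset.mem_union_right _ hv.1) hv.2)
      have hi2 : i % 2 = 1 := by
        by_contra hne
        exact hAB.notMem_right ((hal hi).1 (by omega)) hv.1
      have e : 2 * (i / 2) + 1 = i := by omega
      refine ⟨i / 2, ?_, ?_⟩
      · rw [Finset.mem_filter, Finset.mem_range, e, List.getD_eq_getElem _ _ hi]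
        exact ⟨by omega, hv.2⟩
      · rw [e, List.getD_eq_getElem _ _ hi]
    have hZ : (A.filter (G.Adj y)).card ≤ Z.card := by
      refine card_le_of_forall_exists (fun j => l.getD (2 * j) x) fun v hv => ?_
      rw [Finset.mem_filter] at hv
      obtain ⟨i, hi, rfl⟩ := List.getElem_of_mem (hNy v (Finset.mem_union_left _ hv.1) hv.2)
      have hi2 : i % 2 = 0 := by
        by_contra hne
        exact hAB.notMem_right hv.1 ((hal hi).2 (by omega))
      have e : 2 * (i / 2) = i := by omega
      refine ⟨i / 2, ?_, ?_⟩
      · rw [Finset.mem_filter, Finset.mem_range, e, List.getD_eq_getElem _ _ hi]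
        exact ⟨by omega, hv.2⟩
      · rw [e, List.getD_eq_getElem _ _ hi]
    -- If `x` is adjacent to `l[2j+1]` and `y` to `l[2j]`, then `l[2j], …, l[0], l[2j+1], …, y`
    -- closes up to a cycle through all of `l`.
    have hd : Disjoint J Z := by
      rw [Finset.disjoint_left]
      intro j hj hz
      rw [Finset.mem_filter, Finset.mem_range] at hj hz
      rw [List.getD_eq_getElem _ _ (by omega)] at hj hz
      have hf := hl.flip (p := 2 * j) (r := 2 * j + 1) (by omega) (by
        intro a ha b hb
        rw [List.getElem?_eq_getElem (by omega), Option.mem_some_iff] at ha hb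
        rw [← ha, ← hb]
        exact hj.2)
      refine hcyc _ hf (by simp; omega) l[2 * j] ?_ y ?_ hz.2.symm
      · rw [List.head?_append, List.head?_reverse, List.getLast?_take]
        simp [List.getElem?_eq_getElem (show 2 * j < l.length by omega)]
      · rw [List.getLast?_append, List.getLast?_drop]
        rw [if_neg (by omega), Option.mem_def.1 hy1]
        simp
    calc _ ≤ J.card + Z.card := by omega
      _ = (J ∪ Z).card := (Finset.card_union_of_disjoint hd).symm
      _ ≤ (Finset.range m).card := Finset.card_le_card
        (Finset.union_subset (Finset.filter_subset _ _) (Finset.filter_subset _ _))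
      _ = m := Finset.card_range m
  · have hmem : ∀ v, v ∈ l → v ≠ l[0] → v ≠ l[2 * m - 1] → v ∈ (l.drop 1).take (2 * m - 2) := by
      intro v hv h1 h2
      obtain ⟨i, hi, rfl⟩ := List.getElem_of_mem hv
      have hi0 : i ≠ 0 := by rintro rfl; exact h1 rfl
      have hi1 : i ≠ 2 * m - 1 := by rintro rfl; exact h2 rfl
      rw [List.mem_iff_getElem]
      refine ⟨i - 1, by simp; omega, ?_⟩
      rw [List.getElem_take, List.getElem_drop]
      congr 1
      omega
    have hK := ((hl.drop 1).take (2 * m - 2))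
    refine hconn.sdiff (CutConnected.toFinset hK.chain) ?_ ?_ ?_
    · intro v hv
      rw [List.mem_toFinset] at hv
      have hvS := hK.mem v hv
      rw [List.mem_iff_getElem] at hv
      obtain ⟨i, hi, rfl⟩ := hv
      rw [List.length_take, List.length_drop] at hi
      rw [List.getElem_take, List.getElem_drop] at hvS ⊢
      simp only [Finset.mem_sdiff, hvS, Finset.mem_insert, Finset.mem_singleton, true_and, not_or]
      rw [hl.nodup.getElem_inj_iff, hl.nodup.getElem_inj_iff]
      omega
    · rw [List.toFinset_nonempty_iff]
      intro h
      have := congrArg List.length h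
      simp at this
      omega
    · intro d hd v hv hdv
      rw [Finset.mem_sdiff, Finset.mem_insert, Finset.mem_singleton, not_or] at hv
      rw [Finset.mem_insert, Finset.mem_singleton] at hd
      rw [List.mem_toFinset]
      refine hmem v ?_ hv.2.1 hv.2.2
      rcases hd with rfl | rfl
      · exact hNx v hv.1 hdv
      · exact hNy v hv.1 hdv

/-- A longer path has a prefix of the excluded length. -/
lemma IsPathIn.length_lt {S : Finset V} {n : ℕ} (hmax : ∀ l', IsPathIn G S l' → l'.length ≠ n)
    {l : List V} (hl : IsPathIn G S l) : l.length < n := by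
  by_contra hlt
  exact hmax _ (hl.take n) (by simp; omega)

/-- The degree of the first vertex of a longest path with an odd number of vertices is at most the
number of its neighbours on the path. -/
lemma IsPathIn.card_neighbors_head_le [DecidableRel G.Adj] {X Y : Finset V}
    (hXY : BipartiteOn G X Y) {m : ℕ} {l : List V} (hl : IsPathIn G (X ∪ Y) l)
    (hlen : l.length = 2 * m + 1) (h0 : ∀ x ∈ l[0]?, x ∈ X)
    (hmax : ∀ l', IsPathIn G (X ∪ Y) l' → l'.length ≠ 2 * m + 2) (x : V) (hx : x ∈ l[0]?) :
    (Y.filter (G.Adj x)).card ≤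
      ((Finset.range m).filter fun j => G.Adj x (l.getD (2 * j + 1) x)).card := by
  refine card_le_of_forall_exists (fun j => l.getD (2 * j + 1) x) fun v hv => ?_
  rw [Finset.mem_filter] at hv
  have hvl : v ∈ l := hl.mem_head_of_maximal (by rwa [hlen])
    (by rwa [List.head?_eq_getElem?]) (Finset.mem_union_right _ hv.1) hv.2
  obtain ⟨i, hi, rfl⟩ := List.getElem_of_mem hvl
  have hi2 : i % 2 = 1 := by
    by_contra hne
    exact hXY.notMem_right ((hl.getElem_mem hXY h0 hi).1 (by omega)) hv.1
  have e : 2 * (i / 2) + 1 = i := by omega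
  refine ⟨i / 2, ?_, ?_⟩
  · rw [Finset.mem_filter, Finset.mem_range, e, List.getD_eq_getElem _ _ hi]
    exact ⟨by omega, hv.2⟩
  · rw [e, List.getD_eq_getElem _ _ hi]

/-- If a longest path has both ends in the side `X`, which is not larger than `Y`, then its first
vertex and some vertex of `Y` can be deleted cheaply. -/
lemma exists_pair_of_odd_path [DecidableRel G.Adj] {X Y : Finset V} (hXY : BipartiteOn G X Y)
    {m : ℕ} (hconn : CutConnected G (X ∪ Y)) {l : List V} (hl : IsPathIn G (X ∪ Y) l)
    (hlen : l.length = 2 * m + 1) (hm : 1 ≤ m) (h0 : ∀ x ∈ l[0]?, x ∈ X)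
    (hmax : ∀ l', IsPathIn G (X ∪ Y) l' → l'.length ≠ 2 * m + 2) (hcard : X.card ≤ Y.card) :
    ∃ x ∈ X, ∃ y ∈ Y, ¬ G.Adj x y ∧
      (Y.filter (G.Adj x)).card + (X.filter (G.Adj y)).card ≤ m ∧
      CutConnected G ((X ∪ Y) \ {y}) ∧ CutConnected G ((X ∪ Y) \ {x, y}) := by
  have hal := fun {i} (hi : i < l.length) => hl.getElem_mem hXY h0 hi
  have hlt := fun {l' : List V} (h : IsPathIn G (X ∪ Y) l') => h.length_lt hmax
  set S := X ∪ Y with hS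
  have hlS : l.toFinset ⊆ S := fun v hv => hl.mem v (List.mem_toFinset.1 hv)
  obtain ⟨hcX, hcY⟩ := hl.card_inter hXY h0
  have hOX : ((S \ l.toFinset) ∩ X).card + (X ∩ l.toFinset).card = X.card := by
    rw [← Finset.card_sdiff_add_card_inter X l.toFinset]
    congr 2
    ext v
    simp only [Finset.mem_inter, Finset.mem_sdiff, hS, Finset.mem_union]
    tauto
  have hOY : ((S \ l.toFinset) ∩ Y).card + (Y ∩ l.toFinset).card = Y.card := by
    rw [← Finset.card_sdiff_add_card_inter Y l.toFinset]
    congr 2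
    ext v
    simp only [Finset.mem_inter, Finset.mem_sdiff, hS, Finset.mem_union]
    tauto
  -- The path uses `m + 1` vertices of `X` and only `m` of `Y`, so off the path `Y` is strictly
  -- ahead. The search then yields `q`, leaving the path at `l[p]` and ending at a leaf `c` in `Y`.
  have hO : ((S \ l.toFinset) ∩ X).card < ((S \ l.toFinset) ∩ Y).card := by omega
  obtain ⟨q, hq, ⟨c₀, hc₀, u, hul, huc₀⟩, c, hc, hcY, hcq⟩ :=
    exists_path_to_leaf hXY _ (S \ l.toFinset) Finset.sdiff_subset rfl (fun c => ∃ u ∈ l, G.Adj u c)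
    (by
      intro T hT hTne hcl
      by_contra! hno
      have hTS := hconn T (hT.trans Finset.sdiff_subset) hTne (by
        intro u hu v hv huv
        by_cases hvl : v ∈ l
        · exact absurd huv.symm (hno u hu v hvl)
        · exact hcl u hu v (Finset.mem_sdiff.2 ⟨hv, by simpa using hvl⟩) huv)
      have h1 : l[0] ∈ T := hTS ▸ hl.mem _ (List.getElem_mem _)
      exact (Finset.mem_sdiff.1 (hT h1)).2 (by simp))
    ((Finset.card_pos.1 (by omega : 0 < ((S \ l.toFinset) ∩ Y).card)).mono
      Finset.inter_subset_left)
    (Or.inl hO)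
  obtain ⟨p, hp, rfl⟩ := List.getElem_of_mem hul
  have hqS : IsPathIn G S q := hq.mono Finset.sdiff_subset
  have hql : ∀ v ∈ q, v ∉ l := fun v hv => by simpa using (Finset.mem_sdiff.1 (hq.mem v hv)).2
  have hcq' : c ∈ q := List.mem_of_getLast? hc
  have hcl : c ∉ l := hql c hcq'
  obtain ⟨t, ht⟩ : ∃ t, q.length = t := ⟨_, rfl⟩
  have ht1 : 1 ≤ t := by
    rw [← ht]
    exact List.length_pos_of_mem hcq'
  have hadj0 : ∀ l' : List V, l'.head? = l[p]? → ∀ a ∈ q.reverse.getLast?, ∀ b ∈ l'.head?,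
      G.Adj a b := by
    intro l' hl' a ha b hb
    rw [List.getLast?_reverse, Option.mem_def.1 hc₀, Option.mem_some_iff] at ha
    rw [hl', List.getElem?_eq_getElem hp, Option.mem_some_iff] at hb
    rw [← ha, ← hb]
    exact huc₀.symm
  have hhead : ∀ {i : ℕ}, i < l.length → ∀ l₂ : List V,
      ((l.take (i + 1)).reverse ++ l₂).head? = l[i]? := by
    intro i hi l₂
    rw [List.head?_append, List.head?_reverse, List.getLast?_take]
    simp [List.getElem?_eq_getElem hi]
  have hpt : p + t ≤ 2 * m := by
    have := hlt (hqS.reverse.append (hl.take (p + 1)).reverse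
      (fun v hv hv' => hql v (by simpa using hv) (List.mem_of_mem_take (List.mem_reverse.1 hv')))
      (hadj0 _ (by simpa using hhead hp [])))
    simp at this
    omega
  have htp : t ≤ p := by
    have := hlt (hqS.reverse.append (hl.drop p)
      (fun v hv hv' => hql v (by simpa using hv) (List.mem_of_mem_drop hv'))
      (hadj0 _ (by simp)))
    simp at this
    omega
  have hx0 : l[0] ∈ l.head? := by simp [List.head?_eq_getElem?]
  have hNx : ∀ v ∈ S, G.Adj l[0] v → v ∈ l := fun v hv h =>
    hl.mem_head_of_maximal (by rwa [hlen]) hx0 hv h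
  have hflip : ∀ {i r : ℕ} (hir : i < r) (hr : r < l.length), G.Adj l[0] l[r] →
      IsPathIn G S ((l.take (i + 1)).reverse ++ l.drop r) := by
    intro i r hir hr hadj
    refine hl.flip hir ?_
    intro a ha b hb
    rw [List.getElem?_eq_getElem (by omega), Option.mem_some_iff] at ha hb
    rw [← ha, ← hb]
    exact hadj
  have hflipmem : ∀ {i r : ℕ} {v : V}, v ∈ (l.take (i + 1)).reverse ++ l.drop r → v ∈ l := by
    intro i r v hv
    rcases List.mem_append.1 hv with hv | hv
    exacts [List.mem_of_mem_take (List.mem_reverse.1 hv), List.mem_of_mem_drop hv]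
  -- Otherwise `q` reversed, then `l[p], …, l[0]`, then `l[r], …` would be too long.
  have F2 : ∀ {r : ℕ} (hr : r < l.length), p < r → r ≤ p + t → ¬ G.Adj l[0] l[r] := by
    intro r hr hpr hrt hadj
    have := hlt (hqS.reverse.append (hflip hpr hr hadj)
      (fun v hv hv' => hql v (by simpa using hv) (hflipmem hv')) (hadj0 _ (hhead hp _)))
    simp at this
    omega
  -- Otherwise `c, l[i], …, l[0], l[i+1], …` would be too long; for the last index, `c` itself
  -- extends `l`.
  have F3 : ∀ {i : ℕ} (hi : i < l.length), G.Adj c l[i] →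
      ∃ h : i + 1 < l.length, ¬ G.Adj l[0] l[i + 1] := by
    intro i hi hci
    have h1 : i + 1 < l.length := by
      by_contra hle
      have := hlt (hl.reverse.cons (hqS.mem c hcq') (by simpa using hcl) (by
        intro y hy
        obtain rfl : i = l.length - 1 := by omega
        rw [List.head?_reverse, List.getLast?_eq_getElem?, List.getElem?_eq_getElem (by omega),
          Option.mem_some_iff] at hy
        exact hy ▸ hci))
      simp at this
      omega
    refine ⟨h1, fun hadj => ?_⟩
    have := hlt ((hflip (Nat.lt_succ_self i) h1 hadj).cons (hqS.mem c hcq')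
      (fun hh => hcl (hflipmem hh)) (by
        intro y hy
        rw [hhead hi, List.getElem?_eq_getElem hi, Option.mem_some_iff] at hy
        exact hy ▸ hci))
    simp at this
    omega
  -- Otherwise the detour `l[p], q, l[i]` replaces fewer vertices than it inserts.
  have F4 : ∀ {i : ℕ} (hi : i < l.length), G.Adj c l[i] → p < i → p + t < i := by
    intro i hi hci hpi
    have h1 : IsPathIn G S (q ++ l.drop i) := hqS.append (hl.drop i)
      (fun v hv hv' => hql v hv (List.mem_of_mem_drop hv')) (by
        intro a ha b hb
        rw [Option.mem_def.1 hc, Option.mem_some_iff] at ha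
        rw [List.head?_drop, List.getElem?_eq_getElem hi, Option.mem_some_iff] at hb
        rw [← ha, ← hb]
        exact hci)
    have h2 := hlt ((hl.take (p + 1)).append h1 (by
        intro v hv hv'
        rcases List.mem_append.1 hv' with hv' | hv'
        · exact hql v hv' (List.mem_of_mem_take hv)
        · exact hl.notMem_drop_of_mem_take hpi hv hv') (by
        intro a ha b hb
        rw [List.head?_append, Option.mem_def.1 hc₀] at hb
        rw [List.getLast?_take] at ha
        simp [List.getElem?_eq_getElem hp] at ha hb
        rw [← ha, ← hb]
        exact huc₀))
    simp at h2
    omega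
  obtain ⟨Q, hQ⟩ : ∃ Q, Q = l[p] :: q := ⟨_, rfl⟩
  have hQlen : Q.length = t + 1 := by rw [hQ, List.length_cons, ht]
  have hQp : IsPathIn G S Q := by
    rw [hQ]
    refine hqS.cons (hl.mem _ (List.getElem_mem hp)) (fun h => hql _ h (List.getElem_mem hp)) ?_
    intro y hy
    rw [Option.mem_def.1 hc₀, Option.mem_some_iff] at hy
    exact hy ▸ huc₀
  have hQt : Q[t] = c := by
    have : Q.getLast? = some c := by
      rw [hQ, List.getLast?_cons_of_ne_nil (by rintro rfl; simp at hcq')]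
      exact hc
    rw [List.getLast?_eq_getElem?, hQlen, List.getElem?_eq_getElem (by simp; omega)] at this
    simpa using this
  -- `Q[i]` lies in `X` exactly when `i + p` is even
  have hQpar : ∀ {i : ℕ} (hi : i < Q.length),
      ((i + p) % 2 = 0 → Q[i] ∈ X) ∧ ((i + p) % 2 = 1 → Q[i] ∈ Y) := by
    intro i hi
    rcases Nat.mod_two_eq_zero_or_one p with hp2 | hp2
    · have := hQp.getElem_mem hXY (by simp [hQ, (hal hp).1 hp2]) hi
      exact ⟨fun h => this.1 (by omega), fun h => this.2 (by omega)⟩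
    · rw [hS, Finset.union_comm] at hQp
      have := hQp.getElem_mem hXY.symm (by simp [hQ, (hal hp).2 hp2]) hi
      exact ⟨fun h => this.2 (by omega), fun h => this.1 (by omega)⟩
  have hcard' : (Y.filter (G.Adj l[0])).card + (X.filter (G.Adj c)).card ≤ m := by
    have h1 := hl.card_neighbors_head_le hXY hlen h0 hmax l[0] (by simp)
    -- Each neighbour of `c` is charged to a non-neighbour `l[2j+1]` of `l[0]`. The neighbour
    -- `l[2j]` is charged to `j` by `F3`, and `Q[i]` to `2j = i + p` by `F2`. By `F4` no neighbour
    -- of `c` on `l` beyond `l[p]` falls into the index window reserved for `Q`, and `l[p]` is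
    -- `Q[0]`.
    have h2 : (X.filter (G.Adj c)).card ≤
        ((Finset.range m).filter fun j => ¬ G.Adj l[0] (l.getD (2 * j + 1) l[0])).card := by
      refine card_le_of_forall_exists
        (fun j => if p ≤ 2 * j ∧ 2 * j < p + t then Q.getD (2 * j - p) c
          else l.getD (2 * j) c) fun v hv => ?_
      rw [Finset.mem_filter] at hv
      have hvlQ : v ∈ l ∨ v ∈ Q := by
        by_cases hvl : v ∈ l
        · exact Or.inl hvl
        · right
          rw [hQ]
          exact List.mem_cons_of_mem _ (hcq v (Finset.mem_sdiff.2
            ⟨Finset.mem_union_left _ hv.1, by simpa using hvl⟩) hv.2)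
      have hcaseQ : v ∈ Q → ∃ j ∈ (Finset.range m).filter
          fun j => ¬ G.Adj l[0] (l.getD (2 * j + 1) l[0]),
          (if p ≤ 2 * j ∧ 2 * j < p + t then Q.getD (2 * j - p) c else l.getD (2 * j) c) = v := by
        intro hvQ
        obtain ⟨i, hi, rfl⟩ := List.getElem_of_mem hvQ
        have hi2 : (i + p) % 2 = 0 := by
          by_contra hne
          exact hXY.notMem_right hv.1 ((hQpar hi).2 (by omega))
        have hit : i ≠ t := by
          rintro rfl
          exact hv.2.ne hQt.symm
        have e : 2 * ((i + p) / 2) = i + p := by omega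
        refine ⟨(i + p) / 2, ?_, ?_⟩
        · rw [Finset.mem_filter, Finset.mem_range, e, List.getD_eq_getElem _ _ (by omega)]
          exact ⟨by omega, F2 _ (by omega) (by omega)⟩
        · rw [e, if_pos (by omega), Nat.add_sub_cancel, List.getD_eq_getElem _ _ hi]
      by_cases hvQ : v ∈ Q
      · exact hcaseQ hvQ
      · have hvl := hvlQ.resolve_right hvQ
        obtain ⟨i, hi, rfl⟩ := List.getElem_of_mem hvl
        have hi2 : i % 2 = 0 := by
          by_contra hne
          exact hXY.notMem_right hv.1 ((hal hi).2 (by omega))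
        have hip : i ≠ p := by
          rintro rfl
          simp [hQ] at hvQ
        obtain ⟨h3, h4⟩ := F3 hi hv.2
        have h5 := F4 hi hv.2
        have e : 2 * (i / 2) = i := by omega
        refine ⟨i / 2, ?_, ?_⟩
        · rw [Finset.mem_filter, Finset.mem_range, e, List.getD_eq_getElem _ _ h3]
          exact ⟨by omega, h4⟩
        · rw [e, if_neg (by omega), List.getD_eq_getElem _ _ hi]
    have h3 := Finset.card_filter_add_card_filter_not (s := Finset.range m)
      (fun j => G.Adj l[0] (l.getD (2 * j + 1) l[0]))
    rw [Finset.card_range] at h3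
    omega
  have hdl : q.dropLast ++ [c] = q := List.dropLast_append_getLast? c hc
  have hcdl : c ∉ q.dropLast := by
    have := hqS.nodup
    rw [← hdl, List.nodup_append'] at this
    exact fun h => this.2.2 h (by simp)
  have hNc : ∀ v ∈ S, G.Adj c v → v ∈ l ∨ v ∈ q.dropLast := by
    intro v hv hcv
    by_cases hvl : v ∈ l
    · exact Or.inl hvl
    · right
      have := hcq v (Finset.mem_sdiff.2 ⟨hv, by simpa using hvl⟩) hcv
      rw [← hdl] at this
      simpa [hcv.ne'] using this
  have hdlS : IsPathIn G S q.dropLast := hqS.infix_of (List.dropLast_prefix q).isInfix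
  have hdlhead : ∀ d ∈ q.dropLast.head?, d = c₀ := by
    intro d hd
    rw [← hdl, List.head?_append, Option.mem_def.1 hd] at hc₀
    simpa using hc₀
  -- Here `1 ≤ t ≤ p`, so the branch survives the deletion of `l[0]`.
  have hp1 : l[p] ∈ l.drop 1 := by
    rw [List.mem_iff_getElem]
    exact ⟨p - 1, by simp; omega, by rw [List.getElem_drop]; congr 1; omega⟩
  have hl0 : l[0] ∉ l.drop 1 := by
    intro h
    obtain ⟨i, hi, hh⟩ := List.getElem_of_mem h
    rw [List.getElem_drop, hl.nodup.getElem_inj_iff] at hh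
    omega
  have hl1 : ∀ v ∈ l, v ≠ l[0] → v ∈ l.drop 1 := by
    intro v hv hne
    obtain ⟨i, hi, rfl⟩ := List.getElem_of_mem hv
    have hi0 : i ≠ 0 := by rintro rfl; exact hne rfl
    rw [List.mem_iff_getElem]
    exact ⟨i - 1, by simp; omega, by rw [List.getElem_drop]; congr 1; omega⟩
  refine ⟨l[0], (hal (by omega)).1 rfl, c, hcY, fun h => hcl (hNx c (hqS.mem c hcq') h), hcard',
    ?_, ?_⟩
  · refine hconn.sdiff (K := l.toFinset ∪ q.dropLast.toFinset)
      (CutConnected.union_list (CutConnected.toFinset hl.chain) hdlS.chain ?_) ?_ ?_ ?_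
    · intro d hd
      exact ⟨l[p], by simp, hdlhead d hd ▸ huc₀⟩
    · intro v hv
      rw [Finset.mem_union, List.mem_toFinset, List.mem_toFinset] at hv
      rw [Finset.mem_sdiff, Finset.mem_singleton]
      rcases hv with hv | hv
      · exact ⟨hl.mem v hv, fun h => hcl (h ▸ hv)⟩
      · exact ⟨hdlS.mem v hv, fun h => hcdl (h ▸ hv)⟩
    · exact ⟨l[p], by simp⟩
    · intro d hd v hv hdv
      rw [Finset.mem_singleton] at hd
      subst hd
      rw [Finset.mem_union, List.mem_toFinset, List.mem_toFinset]
      exact hNc v (Finset.mem_sdiff.1 hv).1 hdv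
  · refine hconn.sdiff (K := (l.drop 1).toFinset ∪ q.dropLast.toFinset)
      (CutConnected.union_list (CutConnected.toFinset (hl.drop 1).chain) hdlS.chain ?_) ?_ ?_ ?_
    · intro d hd
      exact ⟨l[p], List.mem_toFinset.2 hp1, hdlhead d hd ▸ huc₀⟩
    · intro v hv
      rw [Finset.mem_union, List.mem_toFinset, List.mem_toFinset] at hv
      rw [Finset.mem_sdiff, Finset.mem_insert, Finset.mem_singleton, not_or]
      rcases hv with hv | hv
      · exact ⟨(hl.drop 1).mem v hv, fun h => hl0 (h ▸ hv),
          fun h => hcl (h ▸ List.mem_of_mem_drop hv)⟩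
      · exact ⟨hdlS.mem v hv, fun h => hql v (List.mem_of_mem_dropLast hv) (h ▸ List.getElem_mem _),
          fun h => hcdl (h ▸ hv)⟩
    · exact ⟨l[p], Finset.mem_union_left _ (List.mem_toFinset.2 hp1)⟩
    · intro d hd v hv hdv
      rw [Finset.mem_sdiff, Finset.mem_insert, Finset.mem_singleton, not_or] at hv
      rw [Finset.mem_insert, Finset.mem_singleton] at hd
      rw [Finset.mem_union, List.mem_toFinset, List.mem_toFinset]
      rcases hd with rfl | rfl
      · exact Or.inl (hl1 v (hNx v hv.1 hdv) hv.2.1)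
      · exact (hNc v hv.1 hdv).imp_left fun h => hl1 v h hv.2.1

/-- If a longest path has both ends in the side `X` and misses a vertex of `Y`, then some vertex of
`X` can be deleted cheaply. -/
lemma exists_vertex_of_odd_path [DecidableRel G.Adj] {X Y : Finset V} (hXY : BipartiteOn G X Y)
    {m : ℕ} (hconn : CutConnected G (X ∪ Y)) {l : List V} (hl : IsPathIn G (X ∪ Y) l)
    (hlen : l.length = 2 * m + 1) (hm : 1 ≤ m) (h0 : ∀ x ∈ l[0]?, x ∈ X)
    (hmax : ∀ l', IsPathIn G (X ∪ Y) l' → l'.length ≠ 2 * m + 2) (hcard : m < Y.card) :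
    ∃ x ∈ X, (Y.filter (G.Adj x)).card < m ∧ CutConnected G ((X ∪ Y) \ {x}) := by
  have hlt := fun {l' : List V} (h : IsPathIn G (X ∪ Y) l') => h.length_lt hmax
  have hNx : ∀ l' x, IsPathIn G (X ∪ Y) l' → l'.length = 2 * m + 1 → x ∈ l'[0]? →
      ∀ v ∈ X ∪ Y, G.Adj x v → v ∈ l' := fun l' x hl' hlen' hx v hv h =>
    hl'.mem_head_of_maximal (by rwa [hlen']) (by rwa [List.head?_eq_getElem?]) hv h
  by_contra! hno
  -- Deleting `l[0]` never disconnects, since its neighbours lie on the rest of the path. So its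
  -- degree is at least `m`, which forces adjacency to every `Y`-vertex of the path.
  have hadj : ∀ j, (h : j < m) → G.Adj l[0] l[2 * j + 1] := by
    have hx := (hl.getElem_mem hXY h0 (show 0 < l.length by omega)).1 rfl
    have h1 := hl.card_neighbors_head_le hXY hlen h0 hmax l[0] (by simp)
    have h2 : m ≤ (Y.filter (G.Adj l[0])).card := by
      by_contra hlt'
      refine hno l[0] hx (by omega) (hconn.sdiff (K := (l.drop 1).toFinset)
        (CutConnected.toFinset (hl.drop 1).chain) ?_ ?_ ?_)
      · intro v hv
        rw [List.mem_toFinset] at hv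
        rw [Finset.mem_sdiff, Finset.mem_singleton]
        refine ⟨(hl.drop 1).mem v hv, ?_⟩
        rintro rfl
        obtain ⟨i, hi, hh⟩ := List.getElem_of_mem hv
        rw [List.getElem_drop, hl.nodup.getElem_inj_iff] at hh
        omega
      · rw [List.toFinset_nonempty_iff]
        intro h
        have := congrArg List.length h
        simp at this
        omega
      · intro d hd v hv hdv
        rw [Finset.mem_singleton] at hd
        subst hd
        rw [Finset.mem_sdiff, Finset.mem_singleton] at hv
        obtain ⟨i, hi, rfl⟩ := List.getElem_of_mem (hNx l _ hl hlen (by simp) v hv.1 hdv)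
        have hi0 : i ≠ 0 := by rintro rfl; exact hv.2 rfl
        rw [List.mem_toFinset, List.mem_iff_getElem]
        exact ⟨i - 1, by simp; omega, by rw [List.getElem_drop]; congr 1; omega⟩
    have h3 : (Finset.range m).filter (fun j => G.Adj l[0] (l.getD (2 * j + 1) l[0])) =
        Finset.range m := by
      refine Finset.eq_of_subset_of_card_le (Finset.filter_subset _ _) ?_
      rw [Finset.card_range]
      omega
    intro j hj
    have h4 : j ∈ (Finset.range m).filter fun j => G.Adj l[0] (l.getD (2 * j + 1) l[0]) := by
      rw [h3, Finset.mem_range]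
      exact hj
    rw [Finset.mem_filter, List.getD_eq_getElem _ _ (by omega)] at h4
    exact h4.2
  have hflip : ∀ {i r : ℕ}, i < r → r % 2 = 1 →
      IsPathIn G (X ∪ Y) ((l.take (i + 1)).reverse ++ l.drop r) := by
    intro i r hir hr
    refine hl.flip hir ?_
    intro a ha b hb
    by_cases hrl : r < l.length
    · rw [List.getElem?_eq_getElem (by omega), Option.mem_some_iff] at ha hb
      rw [← ha, ← hb]
      have := hadj (r / 2) (by omega)
      simpa only [show 2 * (r / 2) + 1 = r by omega] using this
    · rw [List.getElem?_eq_none (by omega)] at hb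
      simp at hb
  have hflipmem : ∀ {i r : ℕ} {v : V}, v ∈ (l.take (i + 1)).reverse ++ l.drop r → v ∈ l := by
    intro i r v hv
    rcases List.mem_append.1 hv with hv | hv
    exacts [List.mem_of_mem_take (List.mem_reverse.1 hv), List.mem_of_mem_drop hv]
  have hhead : ∀ {i : ℕ}, i < l.length → ∀ l₂ : List V,
      ((l.take (i + 1)).reverse ++ l₂).head? = l[i]? := by
    intro i hi l₂
    rw [List.head?_append, List.head?_reverse, List.getLast?_take]
    simp [List.getElem?_eq_getElem hi]
  -- Flipping at `i` makes `l[i]` the first vertex of an equally long path on the same vertices.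
  have heven : ∀ {i : ℕ} (hi : i < l.length), i % 2 = 0 → ∀ v ∈ X ∪ Y, G.Adj l[i] v → v ∈ l := by
    intro i hi hi2 v hv hiv
    refine hflipmem (i := i) (r := i + 1) (hNx _ l[i] (hflip (by omega) (by omega)) ?_ ?_ v hv hiv)
    · simp
      omega
    · rw [← List.head?_eq_getElem?, hhead hi]
      simp
  have hlS : l.toFinset ⊆ X ∪ Y := fun v hv => hl.mem v (List.mem_toFinset.1 hv)
  -- Some vertex of `Y` is off the path, so `T` is not everything and an edge leaves it. By `heven`
  -- that edge must start at a vertex of `X` off the path.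
  set T := l.toFinset ∪ X.filter fun x' => ∃ u ∈ l, G.Adj u x' with hT
  obtain ⟨u, hu, v, hv, hvT, huv⟩ := hconn.exists_adj (T := T)
    (Finset.union_subset hlS ((Finset.filter_subset _ _).trans Finset.subset_union_left))
    ⟨l[0], by simp [hT]⟩ (by
      intro hTS
      have h1 : Y ⊆ Y ∩ l.toFinset := by
        intro y hy
        have : y ∈ T := hTS ▸ Finset.mem_union_right _ hy
        rcases Finset.mem_union.1 this with h | h
        · exact Finset.mem_inter.2 ⟨hy, h⟩
        · exact absurd (Finset.mem_filter.1 h).1 (hXY.symm.notMem_right hy)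
      have h2 := Finset.card_le_card h1
      rw [(hl.card_inter hXY h0).2, hlen] at h2
      omega)
  rw [hT, Finset.mem_union, List.mem_toFinset, Finset.mem_filter, not_or] at hvT
  have aux : ∀ u ∈ l, ∀ v ∈ X ∪ Y, G.Adj u v → v ∉ l → u ∈ Y := by
    intro u hu v hv huv hvl
    obtain ⟨i, hi, rfl⟩ := List.getElem_of_mem hu
    rcases Nat.mod_two_eq_zero_or_one i with hi2 | hi2
    · exact absurd (heven hi hi2 v hv huv) hvl
    · exact (hl.getElem_mem hXY h0 hi).2 hi2
  by_cases hul : u ∈ l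
  · exact hvT.2 ⟨hXY.mem_left (aux u hul v hv huv hvT.1) hv huv, u, hul, huv⟩
  · rw [hT, Finset.mem_union, List.mem_toFinset, Finset.mem_filter] at hu
    obtain ⟨huX, w, hwl, hwu⟩ := hu.resolve_left hul
    have huS : u ∈ X ∪ Y := Finset.mem_union_left _ huX
    have hwY := aux w hwl u huS hwu hul
    obtain ⟨i, hi, rfl⟩ := List.getElem_of_mem hwl
    have hi2 : i % 2 = 1 := by
      by_contra hne
      exact hXY.notMem_right ((hl.getElem_mem hXY h0 hi).1 (by omega)) hwY
    -- The path `v, u, l[i], …, l[0], l[i+2], …` skips only `l[i+1]` and gains two vertices. For `i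
    -- = 2m - 1` the final segment is empty.
    have h1 := (hflip (i := i) (r := i + 2) (by omega) (by omega)).cons huS
      (fun h => hul (hflipmem h)) (by
        intro y hy
        rw [hhead hi, List.getElem?_eq_getElem hi, Option.mem_some_iff] at hy
        exact hy ▸ hwu.symm)
    have h2 := hlt (h1.cons hv (by
        rw [List.mem_cons, not_or]
        exact ⟨huv.ne', fun h => hvT.1 (hflipmem h)⟩) (by
        intro y hy
        simp at hy
        exact hy ▸ huv.symm))
    simp at h2
    omega

/-! ### Cycles and their successor permutation -/

/-- The list `c` is a path in `S` whose ends are adjacent. -/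
structure IsCycleIn (G : SimpleGraph V) (S : Finset V) (c : List V) : Prop
    extends IsPathIn G S c where
  closing : ∀ x ∈ c.head?, ∀ y ∈ c.getLast?, G.Adj x y

namespace IsCycleIn

variable {S : Finset V} {c : List V}

lemma mono (h : IsCycleIn G S c) {S' : Finset V} (hS : S ⊆ S') : IsCycleIn G S' c :=
  ⟨h.toIsPathIn.mono hS, h.closing⟩

lemma rotate (h : IsCycleIn G S c) {i : ℕ} (hi : i < c.length) : IsCycleIn G S (c.rotate i) := by
  rcases Nat.eq_zero_or_pos i with rfl | hi0
  · simpa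
  rw [List.rotate_eq_drop_append_take hi.le]
  refine ⟨(h.drop i).append (h.take i)
    (fun v hv hv' => h.notMem_drop_of_mem_take le_rfl hv' hv) ?_, ?_⟩
  · intro a ha b hb
    rw [List.getLast?_drop, if_neg (by omega)] at ha
    rw [List.head?_take, if_neg (by omega)] at hb
    exact (h.closing b hb a ha).symm
  · intro a ha b hb
    have e : i - 1 + 1 = i := by omega
    have := h.adj (i := i - 1) (by omega)
    rw [List.head?_append, List.head?_drop, List.getElem?_eq_getElem hi] at ha
    rw [List.getLast?_append, List.getLast?_take, if_neg (by omega),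
      List.getElem?_eq_getElem (by omega)] at hb
    simp at ha hb
    simp only [e] at this
    rw [← ha, ← hb]
    exact this.symm

lemma exists_rotate (h : IsCycleIn G S c) {u : V} (hu : u ∈ c) :
    ∃ i, IsCycleIn G S (c.rotate i) ∧ u ∈ (c.rotate i).head? := by
  obtain ⟨i, hi, rfl⟩ := List.getElem_of_mem hu
  refine ⟨i, h.rotate hi, ?_⟩
  rw [List.head?_rotate hi, List.getElem?_eq_getElem hi]
  rfl

lemma exists_path_cons (h : IsCycleIn G S c) {u v : V} (hu : u ∈ c) (hv : v ∈ S) (hvc : v ∉ c)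
    (huv : G.Adj u v) : ∃ c', IsPathIn G S (v :: c') ∧ c'.length = c.length ∧
      ∀ w, w ∈ c' ↔ w ∈ c := by
  obtain ⟨i, hi, hui⟩ := h.exists_rotate hu
  refine ⟨c.rotate i, hi.toIsPathIn.cons hv (by simpa) ?_, by simp, by simp⟩
  intro y hy
  rw [Option.mem_def.1 hui, Option.mem_some_iff] at hy
  exact hy ▸ huv.symm

lemma exists_longer_path (h : IsCycleIn G S c) (hconn : CutConnected G S) (hc : c ≠ [])
    (hcard : c.length < S.card) : ∃ l, IsPathIn G S l ∧ l.length = c.length + 1 := by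
  obtain ⟨u, hu, v, hv, hvc, huv⟩ := hconn.exists_adj (T := c.toFinset)
    (fun v hv => h.mem v (List.mem_toFinset.1 hv)) (by rwa [List.toFinset_nonempty_iff]) (by
      intro he
      rw [← he, List.toFinset_card_of_nodup h.nodup] at hcard
      exact lt_irrefl _ hcard)
  obtain ⟨c', h1, h2, -⟩ := h.exists_path_cons (List.mem_toFinset.1 hu) hv (by simpa using hvc) huv
  exact ⟨_, h1, by simp [h2]⟩

lemma adj_formPerm (h : IsCycleIn G S c) (hlen : 2 ≤ c.length) {u : V} (hu : u ∈ c) :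
    G.Adj u (c.formPerm u) := by
  obtain ⟨i, hi, hui⟩ := h.exists_rotate hu
  rw [← List.formPerm_rotate c h.nodup i]
  have hl : 2 ≤ (c.rotate i).length := by simpa
  rw [List.head?_eq_getElem?, List.getElem?_eq_getElem (by omega), Option.mem_some_iff] at hui
  subst hui
  rw [List.formPerm_apply_lt_getElem _ hi.nodup 0 (by omega)]
  exact hi.adj (by omega)

/-- If `x` and `y` lie off a cycle, are adjacent to `u` and `v` respectively, and no path covers
the cycle together with `x` and `y`, then the successors of `u` and `v` are not adjacent. -/
lemma not_adj_formPerm (h : IsCycleIn G S c) (hlen : 2 ≤ c.length) {u v x y : V} (hu : u ∈ c)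
    (hv : v ∈ c) (huv : u ≠ v) (hx : x ∈ S) (hy : y ∈ S) (hxc : x ∉ c) (hyc : y ∉ c)
    (hxy : x ≠ y) (hux : G.Adj u x) (hvy : G.Adj v y)
    (hmax : ∀ l, IsPathIn G S l → l.length ≠ c.length + 2) :
    ¬ G.Adj (c.formPerm u) (c.formPerm v) := by
  obtain ⟨i, hi, hui⟩ := h.exists_rotate hu
  rw [← List.formPerm_rotate c h.nodup i]
  obtain ⟨d, hd⟩ : ∃ d, d = c.rotate i := ⟨_, rfl⟩
  rw [← hd] at hi hui ⊢
  have hdl : d.length = c.length := by rw [hd, List.length_rotate]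
  have hdm : ∀ w, w ∈ d ↔ w ∈ c := by intro w; rw [hd, List.mem_rotate]
  rw [← hdl] at hmax hlen
  rw [← hdm] at hv hxc hyc
  rw [List.head?_eq_getElem?, List.getElem?_eq_getElem (by omega), Option.mem_some_iff] at hui
  subst hui
  obtain ⟨j, hj, rfl⟩ := List.getElem_of_mem hv
  have hj0 : j ≠ 0 := by rintro rfl; exact huv rfl
  have hxd : IsPathIn G S (x :: d) := hi.toIsPathIn.cons hx hxc (by
    intro w hw
    rw [List.head?_eq_getElem?, List.getElem?_eq_getElem (by omega), Option.mem_some_iff] at hw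
    exact hw ▸ hux.symm)
  intro hadj
  rw [List.formPerm_apply_lt_getElem _ hi.nodup 0 (by omega)] at hadj
  by_cases hjl : j + 1 < d.length
  · rw [List.formPerm_apply_lt_getElem _ hi.nodup j hjl] at hadj
    -- With `u = d[0]` and `v = d[j]`, the forbidden path is `y, d[j], …, d[1], d[j+1], …, d[last],
    -- d[0], x`.
    have hf := (hi.drop 1).flip (p := j - 1) (r := j) (by omega) (by
      intro a ha b hb
      rw [List.getElem?_drop, List.getElem?_eq_getElem (by omega), Option.mem_some_iff] at ha hb
      rw [← ha, ← hb]
      simpa only [Nat.add_comm] using hadj)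
    have hfm : ∀ w, w ∈ ((d.drop 1).take (j - 1 + 1)).reverse ++ (d.drop 1).drop j →
        w ∈ d.drop 1 := by
      intro w hw
      rcases List.mem_append.1 hw with hw | hw
      exacts [List.mem_of_mem_take (List.mem_reverse.1 hw), List.mem_of_mem_drop hw]
    have h0 : d[0] ∉ d.drop 1 := by
      intro h0
      obtain ⟨i, hi', hh⟩ := List.getElem_of_mem h0
      rw [List.getElem_drop, hi.nodup.getElem_inj_iff] at hh
      omega
    have h1 := hf.append (l₂ := [d[0], x]) (⟨by simpa using hux, by simpa using hux.ne,
        by simpa using ⟨hi.mem _ (List.getElem_mem _), hx⟩⟩) (by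
        intro w hw
        have hw' := hfm w hw
        simp only [List.mem_cons, List.not_mem_nil, or_false, not_or]
        exact ⟨fun e => h0 (e ▸ hw'), fun e => hxc (e ▸ List.mem_of_mem_drop hw')⟩) (by
        intro a ha b hb
        rw [List.getLast?_append, List.drop_drop, List.getLast?_drop, if_neg (by omega)] at ha
        simp only [List.head?_cons, Option.mem_some_iff] at hb
        subst hb
        have hla : a ∈ d.getLast? := by
          rw [List.getLast?_eq_getElem?, List.getElem?_eq_getElem (by omega)] at ha ⊢
          simpa using ha
        exact (hi.closing _ (by simp [List.head?_eq_getElem?]) a hla).symm)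
    refine hmax _ (h1.cons hy ?_ ?_) ?_
    · intro hm
      rcases List.mem_append.1 hm with hm | hm
      · exact hyc (List.mem_of_mem_drop (hfm y hm))
      · simp only [List.mem_cons, List.not_mem_nil, or_false] at hm
        rcases hm with rfl | rfl
        · exact hyc (List.getElem_mem _)
        · exact hxy rfl
    · intro w hw
      rw [List.append_assoc, List.head?_append, List.head?_reverse, List.getLast?_take,
        if_neg (by omega), List.getElem?_drop, List.getElem?_eq_getElem (by omega)] at hw
      simp only [Option.some_or, Option.mem_some_iff] at hw
      subst hw
      simpa only [show 1 + (j - 1 + 1 - 1) = j by omega] using hvy.symm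
    · simp
      omega
  -- Here `v` precedes `u` on the cycle, so `x` and `y` extend it at both ends.
  · refine hmax ((x :: d) ++ [y]) (hxd.append (IsPathIn.singleton hy) ?_ ?_) (by simp)
    · intro w hw hwy
      rw [List.mem_singleton] at hwy
      subst hwy
      rcases List.mem_cons.1 hw with rfl | hw
      · exact hxy rfl
      · exact hyc hw
    · intro a ha b hb
      rw [List.getLast?_cons_of_ne_nil (by rintro rfl; simp at hj), List.getLast?_eq_getElem?,
        List.getElem?_eq_getElem (by omega), Option.mem_some_iff] at ha
      simp only [List.head?_cons, Option.mem_some_iff] at hb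
      rw [← ha, ← hb]
      simpa only [show d.length - 1 = j by omega] using hvy

end IsCycleIn

/-! ### Edge counts under deletion and the near-Hamiltonian case -/

variable [DecidableRel G.Adj] {A B : Finset V}

lemma card_interedges_swap : (G.interedges A B).card = (G.interedges B A).card :=
  Finset.card_nbij' Prod.swap Prod.swap
    (fun _ h => by
      rw [Finset.mem_coe, SimpleGraph.mem_interedges_iff] at h ⊢
      exact ⟨h.2.1, h.1, h.2.2.symm⟩)
    (fun _ h => by
      rw [Finset.mem_coe, SimpleGraph.mem_interedges_iff] at h ⊢
      exact ⟨h.2.1, h.1, h.2.2.symm⟩)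
    (fun _ _ => rfl) (fun _ _ => rfl)

lemma card_interedges_le_erase_left (x : V) :
    (G.interedges A B).card ≤ (G.interedges (A.erase x) B).card + (B.filter (G.Adj x)).card := by
  calc (G.interedges A B).card
      ≤ (G.interedges (A.erase x) B ∪ (B.filter (G.Adj x)).image fun y => (x, y)).card := by
        refine Finset.card_le_card ?_
        rintro ⟨u, v⟩ h
        rw [SimpleGraph.mem_interedges_iff] at h
        rw [Finset.mem_union, SimpleGraph.mem_interedges_iff, Finset.mem_image]
        by_cases hux : u = x
        · subst hux
          exact Or.inr ⟨v, Finset.mem_filter.2 h.2, rfl⟩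
        · exact Or.inl ⟨Finset.mem_erase.2 ⟨hux, h.1⟩, h.2⟩
    _ ≤ _ := (Finset.card_union_le _ _).trans (Nat.add_le_add_left Finset.card_image_le _)

lemma card_interedges_le_erase_right (y : V) :
    (G.interedges A B).card ≤ (G.interedges A (B.erase y)).card + (A.filter (G.Adj y)).card := by
  rw [card_interedges_swap, card_interedges_swap (A := A)]
  exact card_interedges_le_erase_left y

lemma card_interedges_le_erase_erase (x y : V) :
    (G.interedges A B).card ≤ (G.interedges (A.erase x) (B.erase y)).card +
      ((B.filter (G.Adj x)).card + (A.filter (G.Adj y)).card) := by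
  have h1 := card_interedges_le_erase_left (G := G) (A := A) (B := B) x
  have h2 := card_interedges_le_erase_right (G := G) (A := A.erase x) (B := B) y
  have h3 : ((A.erase x).filter (G.Adj y)).card ≤ (A.filter (G.Adj y)).card :=
    Finset.card_le_card (Finset.filter_subset_filter _ (Finset.erase_subset _ _))
  omega

/-- A balanced graph with a cycle through all but one vertex of each side, and without a Hamiltonian
path, has few edges. -/
lemma card_interedges_le_of_cycle (hAB : BipartiteOn G A B) {m : ℕ} (hm : 1 ≤ m)
    (hconn : CutConnected G (A ∪ B)) {c : List V} (hc : IsCycleIn G (A ∪ B) c)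
    (hlen : c.length = 2 * m) (hA : A.card = m + 1) (hB : B.card = m + 1)
    (hmax : ∀ l, IsPathIn G (A ∪ B) l → l.length ≠ 2 * m + 2) :
    (G.interedges A B).card ≤ m * m + 1 := by
  have hcard : (A ∩ c.toFinset).card = m ∧ (B ∩ c.toFinset).card = m := by
    have h0 : (c)[0] ∈ A ∪ B := hc.mem _ (List.getElem_mem _)
    rcases Finset.mem_union.1 h0 with h0 | h0
    · have := hc.card_inter hAB (by
        intro x hx
        rw [List.getElem?_eq_getElem (by omega), Option.mem_some_iff] at hx
        exact hx ▸ h0)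
      omega
    · have := (hc.mono (Finset.union_comm A B).subset).card_inter hAB.symm (by
        intro x hx
        rw [List.getElem?_eq_getElem (by omega), Option.mem_some_iff] at hx
        exact hx ▸ h0)
      omega
  have hAd := Finset.card_sdiff_add_card_inter A c.toFinset
  have hBd := Finset.card_sdiff_add_card_inter B c.toFinset
  obtain ⟨x, hx⟩ := Finset.card_eq_one.1 (by omega : (A \ c.toFinset).card = 1)
  obtain ⟨y, hy⟩ := Finset.card_eq_one.1 (by omega : (B \ c.toFinset).card = 1)
  have hx' : x ∈ A \ c.toFinset := hx ▸ Finset.mem_singleton_self x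
  have hy' : y ∈ B \ c.toFinset := hy ▸ Finset.mem_singleton_self y
  rw [Finset.mem_sdiff, List.mem_toFinset] at hx' hy'
  have hAe : A.erase x = A ∩ c.toFinset := by
    rw [← Finset.sdiff_singleton_eq_erase, ← hx, sdiff_sdiff_right_self, Finset.inf_eq_inter]
  have hBe : B.erase y = B ∩ c.toFinset := by
    rw [← Finset.sdiff_singleton_eq_erase, ← hy, sdiff_sdiff_right_self, Finset.inf_eq_inter]
  have hxS : x ∈ A ∪ B := Finset.mem_union_left _ hx'.1
  have hyS : y ∈ A ∪ B := Finset.mem_union_right _ hy'.1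
  have hxney : x ≠ y := fun e => hAB.notMem_right hx'.1 (e ▸ hy'.1)
  have hout : ∀ v ∈ A ∪ B, v ∉ c → v = x ∨ v = y := by
    intro v hv hvc
    rcases Finset.mem_union.1 hv with h | h
    · left
      rw [← Finset.mem_singleton, ← hx]
      simp [h, hvc]
    · right
      rw [← Finset.mem_singleton, ← hy]
      simp [h, hvc]
  have hcardS : (A ∪ B).card = 2 * m + 2 := by
    rw [Finset.card_union_of_disjoint hAB.disjoint]
    omega
  -- By connectivity one of `x`, `y` is attached to the cycle; an edge `xy` would append the other.
  have hxy : ¬ G.Adj x y := by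
    intro hxy
    obtain ⟨u, hu, v, hv, hvc, huv⟩ := hconn.exists_adj (T := c.toFinset)
      (fun v hv => hc.mem v (List.mem_toFinset.1 hv))
      ⟨(c)[0], by simp⟩ (by
        intro he
        rw [← he] at hxS
        exact hx'.2 (List.mem_toFinset.1 hxS))
    rw [List.mem_toFinset] at hu hvc
    obtain ⟨c', h1, h2, h3⟩ := hc.exists_path_cons hu hv hvc huv
    have key : ∀ w ∈ A ∪ B, w ∉ c → G.Adj v w → False := by
      intro w hw hwc hvw
      refine hmax _ (h1.cons hw ?_ ?_) (by simp; omega)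
      · rw [List.mem_cons, not_or, h3]
        exact ⟨hvw.ne', hwc⟩
      · simpa using hvw.symm
    rcases hout v hv hvc with rfl | rfl
    · exact key y hyS hy'.2 hxy
    · exact key x hxS hx'.2 hxy.symm
  have hNx : ∀ v ∈ B, G.Adj x v → v ∈ c := by
    intro v hv hxv
    by_contra hvc
    rcases hout v (Finset.mem_union_right _ hv) hvc with rfl | rfl
    · exact hxv.ne rfl
    · exact hxy hxv
  have hNy : ∀ v ∈ A, G.Adj y v → v ∈ c := by
    intro v hv hyv
    by_contra hvc
    rcases hout v (Finset.mem_union_left _ hv) hvc with rfl | rfl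
    · exact hxy hyv.symm
    · exact hyv.ne rfl
  have hnx : 1 ≤ (B.filter (G.Adj x)).card := by
    obtain ⟨v, hv, hxv⟩ := hconn.exists_neighbor hxS (by omega)
    exact Finset.card_pos.2 ⟨v, Finset.mem_filter.2 ⟨hAB.mem_right hx'.1 hv hxv, hxv⟩⟩
  have hny : 1 ≤ (A.filter (G.Adj y)).card := by
    obtain ⟨v, hv, hyv⟩ := hconn.exists_neighbor hyS (by omega)
    exact Finset.card_pos.2 ⟨v, Finset.mem_filter.2 ⟨hAB.mem_left hy'.1 hv hyv, hyv⟩⟩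
  have hstep := card_interedges_le_erase_erase (G := G) (A := A) (B := B) x y
  -- Each neighbour `u` of `x` and `v` of `y` give a non-edge between the successors of `u` and `v`;
  -- since `σ` is injective these are distinct.
  have hinner : (G.interedges (A.erase x) (B.erase y)).card +
      (B.filter (G.Adj x)).card * (A.filter (G.Adj y)).card ≤ m * m := by
    rw [hAe, hBe]
    set σ := c.formPerm
    set M := (B.filter (G.Adj x) ×ˢ A.filter (G.Adj y)).image fun p => (σ p.1, σ p.2) with hM
    have hMcard : M.card = (B.filter (G.Adj x)).card * (A.filter (G.Adj y)).card := by
      rw [hM, Finset.card_image_of_injective, Finset.card_product]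
      rintro ⟨a, b⟩ ⟨a', b'⟩ h
      simpa using h
    have hMspec : ∀ p ∈ M, p.1 ∈ A ∩ c.toFinset ∧ p.2 ∈ B ∩ c.toFinset ∧ ¬ G.Adj p.1 p.2 := by
      intro p hp
      obtain ⟨⟨u, v⟩, huv, rfl⟩ := Finset.mem_image.1 hp
      rw [Finset.mem_product, Finset.mem_filter, Finset.mem_filter] at huv
      obtain ⟨⟨huB, hxu⟩, hvA, hyv⟩ := huv
      have huc := hNx u huB hxu
      have hvc := hNy v hvA hyv
      have h1 := hc.adj_formPerm (by omega) huc
      have h2 := hc.adj_formPerm (by omega) hvc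
      have h3 : σ u ∈ c := List.formPerm_apply_mem_of_mem huc
      have h4 : σ v ∈ c := List.formPerm_apply_mem_of_mem hvc
      refine ⟨?_, ?_, ?_⟩
      · rw [Finset.mem_inter, List.mem_toFinset]
        exact ⟨hAB.mem_left huB (hc.mem _ h3) h1, h3⟩
      · rw [Finset.mem_inter, List.mem_toFinset]
        exact ⟨hAB.mem_right hvA (hc.mem _ h4) h2, h4⟩
      · refine hc.not_adj_formPerm (by omega) huc hvc ?_ hxS hyS hx'.2 hy'.2 hxney hxu.symm
          hyv.symm (by rwa [hlen])
        intro huv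
        exact hAB.notMem_right hvA (huv ▸ huB)
    rw [← hMcard, ← Finset.card_union_of_disjoint]
    · calc _ ≤ ((A ∩ c.toFinset) ×ˢ (B ∩ c.toFinset)).card := by
            refine Finset.card_le_card (Finset.union_subset (Finset.filter_subset _ _) ?_)
            intro p hp
            obtain ⟨h1, h2, -⟩ := hMspec p hp
            exact Finset.mem_product.2 ⟨h1, h2⟩
        _ = m * m := by rw [Finset.card_product, hcard.1, hcard.2]
    · rw [Finset.disjoint_left]
      rintro p hp hpM
      exact (hMspec p hpM).2.2 ((SimpleGraph.mem_interedges_iff G).1 hp).2.2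
  generalize (B.filter (G.Adj x)).card = n₁ at *
  generalize (A.filter (G.Adj y)).card = n₂ at *
  obtain ⟨n₁, rfl⟩ := Nat.exists_eq_add_of_le hnx
  obtain ⟨n₂, rfl⟩ := Nat.exists_eq_add_of_le hny
  -- After the shift by one, `n₁ * n₂` is `(d(x) - 1) * (d(y) - 1)`, whose nonnegativity gives `d(x)
  -- + d(y) - d(x) * d(y) ≤ 1`.
  nlinarith [Nat.zero_le (n₁ * n₂)]

lemma union_sdiff_pair (hAB : BipartiteOn G A B) {x y : V} (hx : x ∈ A) (hy : y ∈ B) :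
    (A ∪ B) \ {x, y} = A.erase x ∪ B.erase y := by
  have h1 := hAB.notMem_right hx
  have h2 := hAB.symm.notMem_right hy
  ext v
  simp only [Finset.mem_sdiff, Finset.mem_union, Finset.mem_insert, Finset.mem_singleton,
    Finset.mem_erase]
  constructor
  · tauto
  · rintro (⟨h, h'⟩ | ⟨h, h'⟩)
    · exact ⟨Or.inl h', by rintro (rfl | rfl) <;> tauto⟩
    · exact ⟨Or.inr h', by rintro (rfl | rfl) <;> tauto⟩

lemma union_sdiff_singleton_right (hAB : BipartiteOn G A B) {y : V} (hy : y ∈ B) :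
    (A ∪ B) \ {y} = A ∪ B.erase y := by
  have h2 := hAB.symm.notMem_right hy
  ext v
  simp only [Finset.mem_sdiff, Finset.mem_union, Finset.mem_singleton, Finset.mem_erase]
  constructor
  · tauto
  · rintro (h | h)
    · exact ⟨Or.inl h, by rintro rfl; exact h2 h⟩
    · exact ⟨Or.inr h.2, h.1⟩

/-! ### The upper bound by induction -/

/-- The edge bound `m * (b - 1) + a` for connected bipartite graphs with sides of sizes
`m + 2 ≤ a ≤ b` inside `G` and no path on `2 * m + 4` vertices. -/
def EdgeBound (G : SimpleGraph V) [DecidableRel G.Adj] (m : ℕ) : Prop :=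
  ∀ A B : Finset V, BipartiteOn G A B → CutConnected G (A ∪ B) → m + 2 ≤ A.card →
    A.card ≤ B.card → (∀ l, IsPathIn G (A ∪ B) l → l.length ≠ 2 * m + 4) →
    (G.interedges A B).card ≤ m * (B.card - 1) + A.card

/-- The same edge bound when there is no path on `2 * m + 3` vertices and no cycle on `2 * m + 2`
vertices. -/
lemma card_interedges_le_of_no_cycle {m : ℕ}
    (hprev : ∀ m', m = m' + 1 → EdgeBound G m') (n : ℕ) :
    ∀ A B : Finset V, A.card = n → BipartiteOn G A B → CutConnected G (A ∪ B) → m + 1 ≤ A.card →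
    A.card ≤ B.card → (∀ l, IsPathIn G (A ∪ B) l → l.length ≠ 2 * m + 3) →
    (∀ c, IsCycleIn G (A ∪ B) c → c.length ≠ 2 * m + 2) →
    (G.interedges A B).card ≤ m * (B.card - 1) + A.card := by
  induction n with
  | zero => intro A B hn; omega
  | succ n ih =>
    intro A B hn hAB hconn hmA hle hmax hcyc
    by_cases hP : ∃ l, IsPathIn G (A ∪ B) l ∧ l.length = 2 * (m + 1)
    · have hl : ∃ l, IsPathIn G (A ∪ B) l ∧ l.length = 2 * (m + 1) ∧ ∀ x ∈ l[0]?, x ∈ A := by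
        obtain ⟨l, hl, hlen⟩ := hP
        have h0 : l[0] ∈ A ∪ B := hl.mem _ (List.getElem_mem _)
        rcases Finset.mem_union.1 h0 with h0 | h0
        · refine ⟨l, hl, hlen, fun x hx => ?_⟩
          rw [List.getElem?_eq_getElem (by omega), Option.mem_some_iff] at hx
          exact hx ▸ h0
        · refine ⟨l.reverse, hl.reverse, by simpa, fun x hx => ?_⟩
          have := ((hl.mono (Finset.union_comm A B).subset).getElem_mem hAB.symm (by
            intro x hx
            rw [List.getElem?_eq_getElem (by omega), Option.mem_some_iff] at hx
            exact hx ▸ h0) (i := l.length - 1) (by omega)).2 (by omega)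
          rw [← List.head?_eq_getElem?, List.head?_reverse, List.getLast?_eq_getElem?,
            List.getElem?_eq_getElem (by omega), Option.mem_some_iff] at hx
          exact hx ▸ this
      obtain ⟨l, hl, hlen, h0⟩ := hl
      obtain ⟨x, hx, y, hy, -, hdeg, hconn'⟩ := exists_pair_of_even_path hAB hconn hl hlen (by omega)
        h0 hmax (fun l' hl' hlen' x hx y hy hxy => hcyc l' ⟨hl', fun a ha b hb => by
          rw [Option.mem_def.1 hx, Option.mem_some_iff] at ha
          rw [Option.mem_def.1 hy, Option.mem_some_iff] at hb
          exact ha ▸ hb ▸ hxy⟩ hlen')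
      have hstep := card_interedges_le_erase_erase (G := G) (A := A) (B := B) x y
      have hA' := Finset.card_erase_of_mem hx
      have hB' := Finset.card_erase_of_mem hy
      by_cases hlt : m + 1 ≤ A.card - 1
      · rw [union_sdiff_pair hAB hx hy] at hconn'
        have hsub : A.erase x ∪ B.erase y ⊆ A ∪ B :=
          Finset.union_subset_union (Finset.erase_subset _ _) (Finset.erase_subset _ _)
        have := ih (A.erase x) (B.erase y) (by omega)
          (hAB.mono (Finset.erase_subset _ _) (Finset.erase_subset _ _)) hconn' (by omega)
          (by omega) (fun l hl => hmax l (hl.mono hsub)) (fun c hc => hcyc c (hc.mono hsub))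
        rw [hA', hB'] at this
        obtain ⟨b, hb⟩ : ∃ b, B.card = b + 2 := ⟨B.card - 2, by omega⟩
        rw [hb] at this ⊢
        simp only [Nat.add_sub_cancel, show b + 2 - 1 = b + 1 by omega] at this ⊢
        have : m * (b + 1) = m * b + m := by ring
        omega
      -- Now `A` has exactly `m + 1` vertices; the trivial bound `m * (b - 1)` for the rest plus `m
      -- + 1` is exact.
      · have h1 := G.card_interedges_le_mul (A.erase x) (B.erase y)
        rw [hA', hB', show A.card - 1 = m by omega] at h1
        omega
    · push Not at hP
      -- For `m = 0` any edge is a path on two vertices; otherwise the bound for the previous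
      -- parameter applies and is weaker by `b - 1`.
      rcases m with _ | m
      · exfalso
        obtain ⟨u, hu⟩ := Finset.card_pos.1 (by omega : 0 < A.card)
        have hcard := Finset.card_union_of_disjoint hAB.disjoint
        obtain ⟨v, hv, huv⟩ := hconn.exists_neighbor (Finset.mem_union_left B hu) (by omega)
        exact hP [u, v] ⟨by simpa, by simpa using huv.ne,
          by simpa using ⟨Or.inl hu, Finset.mem_union.1 hv⟩⟩ rfl
      · have := hprev m rfl A B hAB hconn hmA hle (fun l hl => by
          have := hP l hl
          omega)
        have h2 : (m + 1) * (B.card - 1) = m * (B.card - 1) + (B.card - 1) := by ring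
        omega

/-- Reduces to the no-cycle bound by deleting a pair in the balanced case and a vertex of the larger
side otherwise, as long as a path on `2 * m + 3` vertices exists. -/
lemma edgeBound_of_no_cycle {m : ℕ} (hprev : ∀ m', m = m' + 1 → EdgeBound G m') :
    EdgeBound G m := by
  have hclaim := fun A B => card_interedges_le_of_no_cycle hprev (A.card) A B rfl
  suffices H : ∀ n, ∀ A B : Finset V, A.card + B.card = n → BipartiteOn G A B →
      CutConnected G (A ∪ B) → m + 2 ≤ A.card → A.card ≤ B.card →
      (∀ l, IsPathIn G (A ∪ B) l → l.length ≠ 2 * m + 4) →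
      (G.interedges A B).card ≤ m * (B.card - 1) + A.card from
    fun A B => H _ A B rfl
  intro n
  induction n using Nat.strong_induction_on with
  | _ n ih =>
  -- the balanced case, with a longest path that has its ends in `A`
  have balanced : ∀ A B : Finset V, A.card + B.card = n → BipartiteOn G A B →
      CutConnected G (A ∪ B) → m + 2 ≤ A.card → A.card = B.card →
      (∀ l, IsPathIn G (A ∪ B) l → l.length ≠ 2 * m + 4) →
      (∃ l, IsPathIn G (A ∪ B) l ∧ l.length = 2 * (m + 1) + 1 ∧ ∀ x ∈ l[0]?, x ∈ A) →
      (G.interedges A B).card ≤ m * (B.card - 1) + A.card := by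
    rintro A B hn hAB hconn hmA heq hmax ⟨l, hl, hlen, h0⟩
    obtain ⟨x, hx, y, hy, -, hdeg, -, hconn'⟩ := exists_pair_of_odd_path hAB hconn hl hlen
      (by omega) h0 hmax heq.le
    rw [union_sdiff_pair hAB hx hy] at hconn'
    have hsub : A.erase x ∪ B.erase y ⊆ A ∪ B :=
      Finset.union_subset_union (Finset.erase_subset _ _) (Finset.erase_subset _ _)
    have hAB' := hAB.mono (Finset.erase_subset x A) (Finset.erase_subset y B)
    have hstep := card_interedges_le_erase_erase (G := G) (A := A) (B := B) x y
    have hA' := Finset.card_erase_of_mem hx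
    have hB' := Finset.card_erase_of_mem hy
    have hfin : (G.interedges (A.erase x) (B.erase y)).card ≤
        m * ((B.erase y).card - 1) + (A.erase x).card →
        (G.interedges A B).card ≤ m * (B.card - 1) + A.card := by
      intro h
      rw [hA', hB'] at h
      obtain ⟨b, hb⟩ : ∃ b, B.card = b + 2 := ⟨B.card - 2, by omega⟩
      rw [hb] at h ⊢
      simp only [Nat.add_sub_cancel, show b + 2 - 1 = b + 1 by omega] at h ⊢
      have : m * (b + 1) = m * b + m := by ring
      omega
    by_cases hlt : m + 2 ≤ A.card - 1
    · exact hfin (ih _ (by omega) (A.erase x) (B.erase y) rfl hAB' hconn' (by omega) (by omega)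
        fun l hl => hmax l (hl.mono hsub))
    -- Both sides have `m + 2` vertices, too few to induct. With a cycle, `(m + 1)² + 1` is exactly
    -- `m * (m + 1) + (m + 2)`. Without one, the no-cycle bound applies after the deletion, since `2
    -- * m + 2` vertices carry no path on `2 * m + 3`.
    · by_cases hcyc : ∃ c, IsCycleIn G (A ∪ B) c ∧ c.length = 2 * (m + 1)
      · obtain ⟨c, hc, hclen⟩ := hcyc
        have := card_interedges_le_of_cycle hAB (by omega) hconn hc hclen (by omega) (by omega) hmax
        rw [show B.card - 1 = m + 1 by omega, show A.card = m + 2 by omega]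
        linarith
      · push Not at hcyc
        refine hfin (hclaim _ _ hAB' hconn' (by omega) (by omega) ?_
          fun c hc => hcyc c (hc.mono hsub))
        intro l hl hlen
        have h1 := Finset.card_le_card
          (fun v hv => hl.mem v (List.mem_toFinset.1 hv) : l.toFinset ⊆ A.erase x ∪ B.erase y)
        rw [List.toFinset_card_of_nodup hl.nodup, Finset.card_union_of_disjoint hAB'.disjoint] at h1
        omega
  intro A B hn hAB hconn hmA hle hmax
  have hcard := Finset.card_union_of_disjoint hAB.disjoint
  by_cases hP : ∃ l, IsPathIn G (A ∪ B) l ∧ l.length = 2 * (m + 1) + 1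
  · obtain ⟨l, hl, hlen⟩ := hP
    have h0 : l[0] ∈ A ∪ B := hl.mem _ (List.getElem_mem _)
    have hhead : ∀ X : Finset V, l[0] ∈ X → ∀ x ∈ l[0]?, x ∈ X := by
      intro X hX x hx
      rw [List.getElem?_eq_getElem (by omega), Option.mem_some_iff] at hx
      exact hx ▸ hX
    have hcomm := Finset.union_comm A B
    by_cases heq : A.card = B.card
    · rcases Finset.mem_union.1 h0 with h0 | h0
      · exact balanced A B hn hAB hconn hmA heq hmax ⟨l, hl, hlen, hhead A h0⟩
      · rw [card_interedges_swap]
        have := balanced B A (by omega) hAB.symm (hcomm ▸ hconn) (by omega) heq.symm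
          (by rwa [← hcomm]) ⟨l, hcomm ▸ hl, hlen, hhead B h0⟩
        rw [heq] at this ⊢
        exact this
    · obtain ⟨y, hy, hdeg, hconn'⟩ : ∃ y ∈ B, (A.filter (G.Adj y)).card ≤ m ∧
          CutConnected G ((A ∪ B) \ {y}) := by
        rcases Finset.mem_union.1 h0 with h0 | h0
        · obtain ⟨x, hx, y, hy, -, hdeg, hconn', -⟩ := exists_pair_of_odd_path hAB hconn hl hlen
            (by omega) (hhead A h0) hmax hle
          -- The degree sum is at most `m + 1` and `x` has a neighbour, so `y` has degree at most
          -- `m`.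
          obtain ⟨v, hv, hxv⟩ := hconn.exists_neighbor (Finset.mem_union_left B hx) (by omega)
          have : 0 < (B.filter (G.Adj x)).card :=
            Finset.card_pos.2 ⟨v, Finset.mem_filter.2 ⟨hAB.mem_right hx hv hxv, hxv⟩⟩
          exact ⟨y, hy, by omega, hconn'⟩
        · rw [hcomm] at hconn hl hmax ⊢
          obtain ⟨y, hy, hdeg, hconn'⟩ := exists_vertex_of_odd_path hAB.symm hconn hl hlen
            (by omega) (hhead B h0) hmax (by omega)
          exact ⟨y, hy, by omega, hconn'⟩
      rw [union_sdiff_singleton_right hAB hy] at hconn'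
      have hB' := Finset.card_erase_of_mem hy
      have h1 := ih _ (by omega) A (B.erase y) rfl
        (hAB.mono (Finset.Subset.refl _) (Finset.erase_subset _ _)) hconn' hmA (by omega)
        fun l hl => hmax l (hl.mono
          (Finset.union_subset_union (Finset.Subset.refl _) (Finset.erase_subset _ _)))
      have h2 := card_interedges_le_erase_right (G := G) (A := A) (B := B) y
      rw [hB'] at h1
      obtain ⟨b, hb⟩ : ∃ b, B.card = b + 2 := ⟨B.card - 2, by omega⟩
      rw [hb] at h1 ⊢
      simp only [Nat.add_sub_cancel, show b + 2 - 1 = b + 1 by omega] at h1 ⊢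
      have : m * (b + 1) = m * b + m := by ring
      omega
  · push Not at hP
    refine hclaim A B hAB hconn (by omega) hle hP fun c hc hclen => ?_
    obtain ⟨l, hl, hlen⟩ := hc.exists_longer_path hconn (by rintro rfl; simp at hclen) (by omega)
    exact hP l hl (by omega)

theorem edgeBound (m : ℕ) : EdgeBound G m := by
  induction m with
  | zero => exact edgeBound_of_no_cycle (by intro m' h; omega)
  | succ m ih => exact edgeBound_of_no_cycle (by
      intro m' h
      obtain rfl : m = m' := by omega
      exact ih)

end

/-! ### Transfer to the sets of edge counts -/

lemma IsPathIn.pathGraph_isContained {V : Type*} [DecidableEq V] {G : SimpleGraph V}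
    {S : Finset V} {l : List V} (h : IsPathIn G S l) : (SimpleGraph.pathGraph l.length).IsContained G := by
  refine ⟨⟨⟨fun i => l[i], ?_⟩, ?_⟩⟩
  · intro i j hij
    rw [SimpleGraph.pathGraph_adj] at hij
    rcases hij with hij | hij
    · have := h.adj (i := i) (by omega)
      simp only [hij] at this
      exact this
    · have := h.adj (i := j) (by omega)
      simp only [hij] at this
      exact this.symm
  · intro i j hij
    exact Fin.ext (h.nodup.getElem_inj_iff.1 hij)

lemma cutConnected_univ {V : Type*} [Fintype V] {G : SimpleGraph V} (h : G.Connected) :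
    CutConnected G Finset.univ := by
  rintro T - ⟨t, ht⟩ hcl
  refine Finset.eq_univ_of_forall fun v => ?_
  obtain ⟨w⟩ := h.preconnected t v
  induction w with
  | nil => exact ht
  | cons huv _ ih => exact ih (hcl _ ht _ (Finset.mem_univ _) huv)

lemma ncard_edgeSet_eq {V : Type*} [DecidableEq V] {G : SimpleGraph V} [DecidableRel G.Adj]
    {A B : Finset V} (h : G.IsBipartiteWith (A : Set V) (B : Set V)) :
    G.edgeSet.ncard = (G.interedges A B).card := by
  have hd := h.disjoint
  rw [Finset.disjoint_coe] at hd
  have he : G.edgeSet = ((G.interedges A B).image fun p => s(p.1, p.2) : Finset (Sym2 V)) := by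
    ext e
    induction e using Sym2.ind with
    | _ u v =>
      rw [SimpleGraph.mem_edgeSet, Finset.mem_coe, Finset.mem_image]
      constructor
      · intro huv
        rcases h.mem_of_adj huv with ⟨hu, hv⟩ | ⟨hu, hv⟩
        · exact ⟨(u, v), (G.mem_interedges_iff).2 ⟨hu, hv, huv⟩, rfl⟩
        · exact ⟨(v, u), (G.mem_interedges_iff).2 ⟨hv, hu, huv.symm⟩, Sym2.eq_swap⟩
      · rintro ⟨p, hp, hpe⟩
        rw [← SimpleGraph.mem_edgeSet, ← hpe, SimpleGraph.mem_edgeSet]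
        exact ((G.mem_interedges_iff).1 hp).2.2
  rw [he, Set.ncard_coe_finset, Finset.card_image_of_injOn]
  rintro ⟨u, v⟩ hp ⟨u', v'⟩ hp' heq
  rw [Finset.mem_coe, SimpleGraph.mem_interedges_iff] at hp hp'
  simp only [Sym2.eq_iff] at heq
  rcases heq with ⟨rfl, rfl⟩ | ⟨rfl, rfl⟩
  · rfl
  · exact absurd hp'.2.1 (Finset.disjoint_left.1 hd hp.1)

lemma le_of_mem_connBipartiteFreeEdgeCounts {k a b n e : ℕ} (hk : 2 ≤ k) (hka : k ≤ a)
    (hab : a ≤ b) (hn : n ≤ 2 * k)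
    (he : e ∈ connBipartiteFreeEdgeCounts a b (SimpleGraph.pathGraph n)) :
    e ≤ (k - 2) * (b - 1) + a := by
  classical
  obtain ⟨V, _, G, A, B, hAB, hbip, rfl, rfl, hconn, hfree, rfl⟩ := he
  have := Fintype.ofFinite V
  obtain ⟨A, rfl⟩ := A.toFinite.exists_finset_coe
  obtain ⟨B, rfl⟩ := B.toFinite.exists_finset_coe
  rw [Set.ncard_coe_finset] at *
  rw [Set.ncard_coe_finset] at *
  have hU : A ∪ B = Finset.univ := by
    rw [← Finset.coe_inj]
    simpa using hAB
  obtain ⟨m, rfl⟩ : ∃ m, k = m + 2 := ⟨k - 2, by omega⟩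
  rw [ncard_edgeSet_eq hbip]
  have hd := hbip.disjoint
  rw [Finset.disjoint_coe] at hd
  refine edgeBound m A B ⟨hd, ?_, ?_⟩ (hU ▸ cutConnected_univ hconn) hka hab ?_
  · intro u hu v hv huv
    exact Finset.disjoint_left.1 hd hv (hbip.mem_of_mem_adj (by simpa using hu) huv)
  · intro u hu v hv huv
    exact Finset.disjoint_left.1 hd (hbip.symm.mem_of_mem_adj (by simpa using hu) huv) hv
  -- A path on `2k` vertices contains one on `n` as a prefix.
  · intro l hl hlen
    have h1 := (hl.take n).pathGraph_isContained
    rw [List.length_take, min_eq_left (by omega)] at h1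
    exact hfree h1

/-! ### The extremal construction -/

/-- The bipartite graph on `Fin a ⊕ Fin b` in which the first `m` vertices of the left side are
joined to all of the right side, and the others to the first vertex of the right side only. -/
def broomGraph (m a b : ℕ) : SimpleGraph (Fin a ⊕ Fin b) where
  Adj
    | .inl i, .inr j => (i : ℕ) < m ∨ (j : ℕ) = 0
    | .inr j, .inl i => (i : ℕ) < m ∨ (j : ℕ) = 0
    | _, _ => False
  symm := ⟨by rintro (i | i) (j | j) h <;> exact h⟩
  loopless := ⟨by rintro (i | i) h <;> exact h⟩

section broomGraph

variable {m a b : ℕ}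

lemma broomGraph_adj_inl_inr {i : Fin a} {j : Fin b} :
    (broomGraph m a b).Adj (.inl i) (.inr j) ↔ (i : ℕ) < m ∨ (j : ℕ) = 0 := Iff.rfl

lemma broomGraph_isBipartiteWith :
    (broomGraph m a b).IsBipartiteWith (Set.range Sum.inl) (Set.range Sum.inr) where
  disjoint := Set.isCompl_range_inl_range_inr.disjoint
  mem_of_adj := by
    rintro (i | i) (j | j) h
    · exact h.elim
    · simp
    · simp
    · exact h.elim

lemma broomGraph_connected (hm : 0 < m) (ha : 0 < a) (hb : 0 < b) :
    (broomGraph m a b).Connected := by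
  have hr : ∀ v, (broomGraph m a b).Reachable v (.inl ⟨0, ha⟩) := by
    have h1 : ∀ j, (broomGraph m a b).Reachable (.inr j) (.inl ⟨0, ha⟩) := fun j =>
      (broomGraph_adj_inl_inr.2 (Or.inl hm)).symm.reachable
    rintro (i | j)
    · have h2 : (broomGraph m a b).Adj (.inl i) (.inr ⟨0, hb⟩) :=
        broomGraph_adj_inl_inr.2 (Or.inr rfl)
      exact h2.reachable.trans (h1 _)
    · exact h1 j
  have : Nonempty (Fin a ⊕ Fin b) := ⟨.inl ⟨0, ha⟩⟩
  exact ⟨fun u v => (hr u).trans (hr v).symm⟩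

lemma broomGraph_ncard_edgeSet (hma : m ≤ a) (hb : 0 < b) :
    (broomGraph m a b).edgeSet.ncard = m * (b - 1) + a := by
  set F : Finset (Fin a × Fin b) := Finset.univ.filter fun p => (p.1 : ℕ) < m ∨ (p.2 : ℕ) = 0
    with hF
  have he : (broomGraph m a b).edgeSet =
      (F.image fun p => s(Sum.inl p.1, Sum.inr p.2) : Finset (Sym2 (Fin a ⊕ Fin b))) := by
    ext e
    induction e using Sym2.ind with
    | _ u v =>
      rw [SimpleGraph.mem_edgeSet, Finset.mem_coe, Finset.mem_image]
      constructor
      · intro huv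
        rcases u with i | i <;> rcases v with j | j
        · exact huv.elim
        · exact ⟨(i, j), Finset.mem_filter.2 ⟨Finset.mem_univ _, huv⟩, rfl⟩
        · exact ⟨(j, i), Finset.mem_filter.2 ⟨Finset.mem_univ _, huv⟩, Sym2.eq_swap⟩
        · exact huv.elim
      · rintro ⟨p, hp, hpe⟩
        rw [← SimpleGraph.mem_edgeSet, ← hpe, SimpleGraph.mem_edgeSet]
        exact (Finset.mem_filter.1 hp).2
  rw [he, Set.ncard_coe_finset, Finset.card_image_of_injective]
  · rw [hF, Finset.card_filter, Fintype.sum_prod_type]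
    have hinner : ∀ i : Fin a, (∑ j : Fin b, if (i : ℕ) < m ∨ (j : ℕ) = 0 then 1 else 0) =
        if (i : ℕ) < m then b else 1 := by
      intro i
      by_cases hi : (i : ℕ) < m
      · simp [hi]
      · rw [if_neg hi, Finset.sum_eq_single (⟨0, hb⟩ : Fin b)]
        · simp
        · intro j _ hj
          rw [if_neg]
          rintro (h | h)
          · exact hi h
          · exact hj (Fin.ext h)
        · simp
    rw [Finset.sum_congr rfl fun i _ => hinner i,
      Fin.sum_univ_eq_sum_range (fun i => if i < m then b else 1) a]
    obtain ⟨c, rfl⟩ := Nat.exists_eq_add_of_le hma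
    obtain ⟨b, rfl⟩ := Nat.exists_eq_add_of_le' hb
    rw [Finset.sum_range_add, Finset.sum_congr rfl fun i hi => if_pos (Finset.mem_range.1 hi)]
    simp
    ring
  · rintro ⟨i, j⟩ ⟨i', j'⟩ h
    simpa using h

/-- A left vertex that is not full has a single neighbour, so it can only be an end of a path. In
each case `m + 1` consecutive left positions, starting at `0`, `1` or `2`, would all be full. -/
lemma broomGraph_free (hm : 0 < m) {n : ℕ} (hn : 2 * m + 3 ≤ n) :
    (SimpleGraph.pathGraph n).Free (broomGraph m a b) := by
  rintro ⟨f⟩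
  have hadj : ∀ i (h : i + 1 < n), (broomGraph m a b).Adj (f ⟨i, by omega⟩) (f ⟨i + 1, h⟩) := by
    intro i h
    exact f.toHom.map_adj (SimpleGraph.pathGraph_adj.2 (Or.inl rfl))
  have hinj : ∀ i j (hi : i < n) (hj : j < n), f ⟨i, hi⟩ = f ⟨j, hj⟩ → i = j := by
    intro i j hi hj h
    simpa using f.injective h
  -- there are only `m` full vertices on the left side
  have pigeon : ∀ e (_ : e ≤ 2), ¬ ∀ j (hj : j < m + 1),
      ∃ i : Fin a, f ⟨2 * j + e, by omega⟩ = .inl i ∧ (i : ℕ) < m := by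
    intro e he h
    choose g hg hgm using h
    have hcard := Fintype.card_le_of_injective
      (fun j : Fin (m + 1) => (⟨g j j.2, hgm j j.2⟩ : Fin m)) (by
        intro j j' hjj
        have h1 : g j j.2 = g j' j'.2 := Fin.ext (by simpa using hjj)
        have h2 := hinj _ _ _ _ ((hg j j.2).trans ((congrArg Sum.inl h1).trans (hg j' j'.2).symm))
        exact Fin.ext (by omega))
    simp at hcard
  have interior : ∀ p (hp : p + 2 < n) (i : Fin a), f ⟨p + 1, by omega⟩ = .inl i → (i : ℕ) < m := by
    intro p hp i hi
    by_contra him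
    have h1 := (hadj p (by omega)).symm
    have h2 := hadj (p + 1) hp
    rw [hi] at h1 h2
    rcases e1 : f ⟨p, by omega⟩ with x | x
    · rw [e1] at h1; exact h1.elim
    rcases e2 : f ⟨p + 1 + 1, hp⟩ with y | y
    · rw [e2] at h2; exact h2.elim
    rw [e1, broomGraph_adj_inl_inr] at h1
    rw [e2, broomGraph_adj_inl_inr] at h2
    have hxy : x = y := Fin.ext ((h1.resolve_left him).trans (h2.resolve_left him).symm)
    have := hinj _ _ _ _ (e1.trans ((congrArg Sum.inr hxy).trans e2.symm))
    omega
  have alt : ∀ p (hp : p + 1 < n), (f ⟨p, by omega⟩).isLeft = !(f ⟨p + 1, hp⟩).isLeft := by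
    intro p hp
    have h := hadj p hp
    rcases e1 : f ⟨p, by omega⟩ with x | x <;> rcases e2 : f ⟨p + 1, hp⟩ with y | y
    · rw [e1, e2] at h; exact h.elim
    · rfl
    · rfl
    · rw [e1, e2] at h; exact h.elim
  have alt2 : ∀ e (_ : e ≤ 1), ∀ j (hj : 2 * j + e < n),
      (f ⟨2 * j + e, hj⟩).isLeft = (f ⟨e, by omega⟩).isLeft := by
    intro e he j
    induction j with
    | zero => intro hj; simp
    | succ j ih =>
      intro hj
      have h1 := alt (2 * j + e) (by omega)
      have h2 := alt (2 * j + e + 1) (by omega)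
      rw [← ih (by omega), h1, h2, Bool.not_not]
      congr 3
      omega
  have left_of : ∀ e (_ : e ≤ 1), (f ⟨e, by omega⟩).isLeft = true → ∀ j (hj : 2 * j + e < n),
      ∃ i, f ⟨2 * j + e, hj⟩ = .inl i := by
    intro e he h j hj
    rw [← alt2 e he j hj] at h
    exact Sum.isLeft_iff.1 h
  rcases h0 : (f ⟨0, by omega⟩).isLeft with _ | _
  · -- the left vertices of the path are interior
    have h1 : (f ⟨1, by omega⟩).isLeft = true := by
      have := alt 0 (by omega)
      rw [h0] at this
      simpa using this
    refine pigeon 1 (by omega) fun j hj => ?_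
    obtain ⟨i, hi⟩ := left_of 1 le_rfl h1 j (by omega)
    exact ⟨i, hi, interior (2 * j) (by omega) i hi⟩
  · have hleft := left_of 0 (by omega) h0
    obtain ⟨i₀, hi₀⟩ := hleft 0 (by omega)
    by_cases hfull : (i₀ : ℕ) < m
    · refine pigeon 0 (by omega) fun j hj => ?_
      rcases j with _ | j
      · exact ⟨i₀, hi₀, hfull⟩
      · obtain ⟨i, hi⟩ := hleft (j + 1) (by omega)
        exact ⟨i, hi, interior (2 * j + 1) (by omega) i hi⟩
    -- The first vertex is not full. A second such vertex would share its only neighbour, hence sit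
    -- at position `2`, which is interior because `0 < m` gives `5 ≤ n`.
    · refine pigeon 2 le_rfl fun j hj => ?_
      obtain ⟨i, hi⟩ := hleft (j + 1) (by omega)
      refine ⟨i, hi, ?_⟩
      by_contra hlast
      have h1 := hadj 0 (by omega)
      have h2 := (hadj (2 * j + 1) (by omega)).symm
      rw [show f ⟨2 * j + 1 + 1, by omega⟩ = .inl i from hi] at h2
      rw [show f ⟨0, by omega⟩ = .inl i₀ from hi₀] at h1
      rcases e1 : f ⟨0 + 1, by omega⟩ with x | x
      · rw [e1] at h1; exact h1.elim
      rcases e2 : f ⟨2 * j + 1, by omega⟩ with y | y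
      · rw [e2] at h2; exact h2.elim
      rw [e1, broomGraph_adj_inl_inr] at h1
      rw [e2, broomGraph_adj_inl_inr] at h2
      have hxy : x = y := Fin.ext ((h1.resolve_left hfull).trans (h2.resolve_left hlast).symm)
      have hj0 := hinj _ _ _ _ (e1.trans ((congrArg Sum.inr hxy).trans e2.symm))
      obtain rfl : j = 0 := by omega
      exact hlast (interior 1 (by omega) i hi)

end broomGraph

lemma mem_connBipartiteFreeEdgeCounts {k a b n : ℕ} (hk : 3 ≤ k) (hka : k ≤ a) (hab : a ≤ b)
    (hn : 2 * k - 1 ≤ n) :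
    (k - 2) * (b - 1) + a ∈ connBipartiteFreeEdgeCounts a b (SimpleGraph.pathGraph n) := by
  refine ⟨Fin a ⊕ Fin b, inferInstance, broomGraph (k - 2) a b, Set.range Sum.inl,
    Set.range Sum.inr, Set.range_inl_union_range_inr, broomGraph_isBipartiteWith, ?_, ?_,
    broomGraph_connected (by omega) (by omega) (by omega), broomGraph_free (by omega) (by omega),
    broomGraph_ncard_edgeSet (by omega) (by omega)⟩
  · rw [← Set.image_univ, Set.ncard_image_of_injective _ Sum.inl_injective]
    simp
  · rw [← Set.image_univ, Set.ncard_image_of_injective _ Sum.inr_injective]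
    simp

end BipartitePath

/-- The path `P_n` is the path on `n` vertices, `SimpleGraph.pathGraph n`. Besides the values of the
two extremal numbers, the conclusion records that both maxima exist and are attained. -/
theorem theorem1 (k a b : ℕ) (hk : 3 ≤ k) (hka : k ≤ a) (hab : a ≤ b) :
    (exBipartiteConn a b (SimpleGraph.pathGraph (2 * k)) =
        exBipartiteConn a b (SimpleGraph.pathGraph (2 * k - 1)) ∧
      exBipartiteConn a b (SimpleGraph.pathGraph (2 * k - 1)) = (k - 2) * (b - 1) + a) ∧
    IsGreatest (connBipartiteFreeEdgeCounts a b (SimpleGraph.pathGraph (2 * k)))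
      ((k - 2) * (b - 1) + a) ∧
    IsGreatest (connBipartiteFreeEdgeCounts a b (SimpleGraph.pathGraph (2 * k - 1)))
      ((k - 2) * (b - 1) + a) := by
  -- The construction needs only `2 * k - 1 ≤ n` and the upper bound only `n ≤ 2 * k`, so both paths
  -- are treated at once.
  have key : ∀ n, 2 * k - 1 ≤ n → n ≤ 2 * k →
      IsGreatest (connBipartiteFreeEdgeCounts a b (SimpleGraph.pathGraph n))
        ((k - 2) * (b - 1) + a) := fun n h1 h2 =>
    ⟨BipartitePath.mem_connBipartiteFreeEdgeCounts hk hka hab h1, fun _ he =>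
      BipartitePath.le_of_mem_connBipartiteFreeEdgeCounts (by omega) hka hab h2 he⟩
  have h1 := key (2 * k) (by omega) le_rfl
  have h2 := key (2 * k - 1) le_rfl (by omega)
  exact ⟨⟨h1.csSup_eq.trans h2.csSup_eq.symm, h2.csSup_eq⟩, h1, h2⟩
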